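/- Let $m\ge 1$ and $n>2m+1$ be integers. Let $C_n$ be the polygon matroid of the $n$-cycle, on the ground set $\{1,\dots,n\}$, and let $M_0$ be the polygon matroid of the graph $G_m$ with vertices $0,1,\dots,2m-1$ and edges $\{i,i+1\}$ for $1\le i<2m-1$ and $\{0,i\}$ for $1\le i<2m$. For $m\le i\le 2m-1$ there is a parallel connection $P^n_i$ of $C_n$ and $M_0$ which identifies the point $1$ of $C_n$ with the point $\varepsilon_i=\{0,i\}$ of $M_0$, that is, the matroid on the union of $\{1,\dots,n\}$ and the edge set of $G_m$ with $1$ and $\varepsilon_i$ identified, whose circuits are the circuits of $C_n$, the circuits of $M_0$, and the sets $(C\setminus\{1\})\cup(C'\setminus\{\varepsilon_i\})$ with $C\ni 1$ a circuit of $C_n$ and $C'\ni\varepsilon_i$ a circuit of $M_0$. Let $M'_{n,i}=P^n_i\oplus S$ be its direct sum with an isthmus $S$ (the matroid of rank one on one point). Then the $m$ matroids $M'_{n,i}$, $m\le i\le 2m-1$, are finite, simple and pairwise non-isomorphic, and for every commutative ring $R$ their Orlik-Solomon ($OS$) algebras over $R$ are all isomorphic as graded $R$-algebras. Here the $OS$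 algebra of a finite simple matroid $M$ with ground set $E$ is $A(M)=\Lambda(E)/I(M)$, where $\Lambda(E)$ is the free exterior algebra over $R$ on degree-one generators $e_i$, $i\in E$, and $I(M)$ is the ideal generated by the elements $\sum_{j=1}^k(-1)^{j-1}e_{i_1}\cdots\widehat{e_{i_j}}\cdots e_{i_k}$ for all circuits $\{i_1,\dots,i_k\}$ of $M$. In particular, for every positive integer $m$ there exist $m$ pairwise non-isomorphic simple matroids with isomorphic $OS$ algebras. -/

import Mathlib

noncomputable section

namespace OSMatroid

universe u v w

/-! ### Simplicity and isomorphism of matroids -/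

/-- A matroid is simple if it has no loops (`e = f` below) and no multiple points (`e ≠ f`). -/
def IsSimple {α : Type u} (M : Matroid α) : Prop :=
  ∀ e ∈ M.E, ∀ f ∈ M.E, M.Indep {e, f}

/-- Two matroids are isomorphic if some bijection of their ground sets preserves independence
in both directions. -/
def Isomorphic {α : Type u} {β : Type v} (M : Matroid α) (N : Matroid β) : Prop :=
  ∃ φ : M.E ≃ N.E, ∀ I : Set M.E,
    M.Indep (Subtype.val '' I) ↔ N.Indep (Subtype.val '' (φ '' I))

/-! ### Orlik-Solomon algebras -/

section OrlikSolomon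

variable (R : Type w) [CommRing R] {α : Type u}

/-- The free exterior algebra `Λ(E)` on a set `E` of generators. -/
abbrev FreeExterior (E : Type u) : Type (max u w) := ExteriorAlgebra R (E →₀ R)

/-- The degree one generator `e_i` of `Λ(E)`. -/
def gen {E : Type u} (i : E) : FreeExterior R E := ExteriorAlgebra.ι R (Finsupp.single i 1)

/-- The product `e_{i₁} ⋯ e_{iₖ}` in `Λ(E)`. -/
def monomial {E : Type u} (l : List E) : FreeExterior R E := (l.map (gen R)).prod

/-- The linear map `∂ : Λ(E) → Λ(E)`, as the contraction with the linear form that takes the value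
`1` on each generator; `boundary_monomial` gives its values on products of generators. -/
def boundary (E : Type u) : FreeExterior R E →ₗ[R] FreeExterior R E :=
  CliffordAlgebra.contractLeft (Finsupp.linearCombination R (fun _ : E => (1 : R)))

/-- `∂(e_{i₁} ⋯ e_{iₖ}) = ∑_j (-1)^{j-1} e_{i₁} ⋯ ê_{i_j} ⋯ e_{iₖ}` (with `j` counted from `0`). -/
theorem boundary_monomial {E : Type u} (l : List E) :
    boundary R E (monomial R l) =
      ∑ j : Fin l.length, (-1 : R) ^ (j : ℕ) • monomial R (l.eraseIdx j) := by
  induction l with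
  | nil => simp [monomial, boundary]
  | cons a l ih =>
    have h : monomial R (a :: l) = gen R a * monomial R l := by simp [monomial]
    have h2 : boundary R E (gen R a * monomial R l) =
        monomial R l - gen R a * boundary R E (monomial R l) := by
      unfold boundary gen ExteriorAlgebra.ι
      rw [CliffordAlgebra.contractLeft_ι_mul]
      simp
    rw [h, h2, ih]
    simp only [List.length_cons, Fin.sum_univ_succ]
    simp [monomial, pow_succ, Finset.mul_sum, sub_eq_add_neg]

/-- The set of all `∂(e_{i₁} ⋯ e_{iₖ})` with `{i₁, …, iₖ}` a circuit of `M` (listed without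
repetition, in any order). -/
def circuitBoundaries (M : Matroid α) : Set (FreeExterior R M.E) :=
  {x | ∃ l : List M.E, l.Nodup ∧ M.IsCircuit (Subtype.val '' {i : M.E | i ∈ l}) ∧
    x = boundary R M.E (monomial R l)}

/-- The ideal `I(M)` of `Λ(E)` generated by the boundaries of the circuits. -/
def osIdeal (M : Matroid α) : TwoSidedIdeal (FreeExterior R M.E) :=
  TwoSidedIdeal.span (circuitBoundaries R M)

/-- The Orlik-Solomon algebra `A(M) = Λ(E) / I(M)`. -/
abbrev OSAlgebra (M : Matroid α) : Type (max u w) := (osIdeal R M).ringCon.Quotient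

/-- The degree `p` part `A^p(M)`: the image of `Λ^p(E)`. -/
def osDegree (M : Matroid α) (p : ℕ) : Submodule R (OSAlgebra R M) :=
  (⋀[R]^p (M.E →₀ R)).map ((osIdeal R M).ringCon.mkₐ (α := R)).toLinearMap

/-- `A(M)` and `A(N)` are isomorphic as graded algebras over `R`. -/
def OSIsomorphic {β : Type v} (M : Matroid α) (N : Matroid β) : Prop :=
  ∃ f : OSAlgebra R M ≃ₐ[R] OSAlgebra R N,
    ∀ p : ℕ, (osDegree R M p).map f.toLinearMap = osDegree R N p

end OrlikSolomon

/-! ### The polygon matroid of a graph, the `n`-cycle, and the isthmus -/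

section Polygon

variable {V : Type u} [Finite V]

/-- The augmentation property of forests: a forest `I ⊆ G` that is not maximal can be enlarged by an
edge of any maximal forest `B ⊆ G`. -/
theorem forest_augment {W : Type u} (G : SimpleGraph W) {I B : Set (Sym2 W)}
    (hI : I ⊆ G.edgeSet ∧ (SimpleGraph.fromEdgeSet I).IsAcyclic)
    (hI' : ¬ Maximal (fun I => I ⊆ G.edgeSet ∧ (SimpleGraph.fromEdgeSet I).IsAcyclic) I)
    (hB : Maximal (fun I => I ⊆ G.edgeSet ∧ (SimpleGraph.fromEdgeSet I).IsAcyclic) B) :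
    ∃ x ∈ B \ I, insert x I ⊆ G.edgeSet ∧
      (SimpleGraph.fromEdgeSet (insert x I)).IsAcyclic := by
  have eS : ∀ J : Set (Sym2 W), J ⊆ G.edgeSet → (SimpleGraph.fromEdgeSet J).edgeSet = J := by
    intro J hJ
    rw [SimpleGraph.edgeSet_fromEdgeSet, sdiff_eq_left, Set.disjoint_left]
    exact fun e he => G.not_isDiag_of_mem_edgeSet (hJ he)
  have key : ∀ J : Set (Sym2 W), J ⊆ G.edgeSet → (SimpleGraph.fromEdgeSet J).IsAcyclic →
      (Maximal (fun I => I ⊆ G.edgeSet ∧ (SimpleGraph.fromEdgeSet I).IsAcyclic) J ↔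
        (SimpleGraph.fromEdgeSet J).Reachable = G.Reachable) := by
    intro J hJ hac
    have hle : SimpleGraph.fromEdgeSet J ≤ G := by
      rw [← SimpleGraph.edgeSet_subset_edgeSet, eS J hJ]; exact hJ
    rw [← SimpleGraph.maximal_isAcyclic_iff_reachable_eq hle hac]
    refine ⟨fun h => ⟨⟨hle, hac⟩, ?_⟩, fun h => ⟨⟨hJ, hac⟩, ?_⟩⟩
    · intro H hH hJH
      have h1 : J ⊆ H.edgeSet := by
        have := SimpleGraph.edgeSet_subset_edgeSet.2 hJH
        rwa [eS J hJ] at this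
      have h2 := h.2 (y := H.edgeSet)
        ⟨SimpleGraph.edgeSet_subset_edgeSet.2 hH.1, by simpa using hH.2⟩ h1
      simpa using SimpleGraph.fromEdgeSet_mono h2
    · intro K hK hJK
      have hKle : SimpleGraph.fromEdgeSet K ≤ G := by
        rw [← SimpleGraph.edgeSet_subset_edgeSet, eS K hK.1]; exact hK.1
      have := SimpleGraph.edgeSet_subset_edgeSet.2
        (h.2 ⟨hKle, hK.2⟩ (SimpleGraph.fromEdgeSet_mono hJK))
      rwa [eS J hJ, eS K hK.1] at this
  by_contra hcon
  push Not at hcon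
  apply hI'
  rw [key I hI.1 hI.2]
  have hBr := (key B hB.1.1 hB.1.2).1 hB
  have hadj : ∀ a b, (SimpleGraph.fromEdgeSet B).Adj a b →
      (SimpleGraph.fromEdgeSet I).Reachable a b := by
    intro a b hab
    rw [SimpleGraph.fromEdgeSet_adj] at hab
    by_contra hr
    have hnI : s(a, b) ∉ I := fun h =>
      hr (SimpleGraph.Adj.reachable ((SimpleGraph.fromEdgeSet_adj _).2 ⟨h, hab.2⟩))
    refine hcon s(a, b) ⟨hab.1, hnI⟩ (Set.insert_subset (hB.1.1 hab.1) hI.1) ?_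
    have := SimpleGraph.IsAcyclic.sup_edge_of_not_reachable hr hI.2
    rwa [SimpleGraph.edge, ← SimpleGraph.fromEdgeSet_union, Set.union_comm, ← Set.insert_eq] at this
  funext a b
  apply propext
  constructor
  · refine SimpleGraph.Reachable.mono ?_
    rw [← SimpleGraph.edgeSet_subset_edgeSet, eS I hI.1]
    exact hI.1
  · intro h
    rw [← hBr] at h
    obtain ⟨p⟩ := h
    induction p with
    | nil => exact SimpleGraph.Reachable.refl _
    | cons hab _ ih => exact (hadj _ _ hab).trans ih

/-- The polygon matroid of a finite graph: its points are the edges, and a set of edges is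
independent if it contains no cycle. -/
def polygonMatroid (G : SimpleGraph V) : Matroid (Sym2 V) :=
  (IndepMatroid.ofBdd G.edgeSet
    (fun I => I ⊆ G.edgeSet ∧ (SimpleGraph.fromEdgeSet I).IsAcyclic)
    (by simp)
    (fun _ _ hJ hIJ => ⟨hIJ.trans hJ.1, hJ.2.anti (SimpleGraph.fromEdgeSet_mono hIJ)⟩)
    (fun _ _ hI hI' hB => forest_augment G hI hI' hB)
    (fun _ hI => hI.1)
    ⟨(Set.univ : Set (Sym2 V)).ncard, fun I _ => by
      rw [Set.finite_univ.cast_ncard_eq]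
      exact Set.encard_le_encard (Set.subset_univ I)⟩).matroid

end Polygon

/-- The polygon matroid `C_n` of the `n`-cycle, with ground set `[n] = {1, …, n}`: the sets of at
most `n - 1` points are independent. -/
def cycleMatroid (n : ℕ) : Matroid ℕ :=
  (IndepMatroid.ofFinite (Set.finite_Icc 1 n)
    (fun I => I ⊆ Set.Icc 1 n ∧ I.ncard ≤ n - 1)
    (by simp)
    (fun _ _ hJ hIJ => ⟨hIJ.trans hJ.1,
      (Set.ncard_le_ncard hIJ ((Set.finite_Icc 1 n).subset hJ.1)).trans hJ.2⟩)
    (by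
      intro I J hI hJ hlt
      obtain ⟨e, heJ, heI⟩ := Set.exists_mem_notMem_of_ncard_lt_ncard hlt
        ((Set.finite_Icc 1 n).subset hI.1)
      refine ⟨e, heJ, heI, Set.insert_subset (hJ.1 heJ) hI.1, ?_⟩
      have h1 := Set.ncard_insert_le e I
      have h2 := hJ.2
      omega)
    (fun _ hI => hI.1)).matroid

/-- `C_n` has exactly one circuit, the set of all its `n` points. -/
theorem cycleMatroid_isCircuit_iff {n : ℕ} (hn : 1 ≤ n) (C : Set ℕ) :
    (cycleMatroid n).IsCircuit C ↔ C = Set.Icc 1 n := by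
  have hcard : (Set.Icc 1 n).ncard = n := by
    rw [← Finset.coe_Icc, Set.ncard_coe_finset]; simp
  have hdep : ∀ D : Set ℕ, (cycleMatroid n).Dep D ↔ D = Set.Icc 1 n := by
    intro D
    have h1 : (cycleMatroid n).Dep D ↔
        ¬ (D ⊆ Set.Icc 1 n ∧ D.ncard ≤ n - 1) ∧ D ⊆ Set.Icc 1 n := by
      simp [Matroid.Dep, cycleMatroid]
    rw [h1]
    constructor
    · rintro ⟨h2, h3⟩
      refine Set.eq_of_subset_of_ncard_le h3 ?_ (Set.finite_Icc 1 n)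
      have : ¬ D.ncard ≤ n - 1 := fun h => h2 ⟨h3, h⟩
      omega
    · rintro rfl
      refine ⟨fun h => ?_, subset_rfl⟩
      have := h.2
      omega
  rw [Matroid.isCircuit_def, Minimal]
  simp only [hdep]
  constructor
  · exact fun h => h.1
  · rintro rfl
    exact ⟨rfl, fun D hD _ => hD ▸ le_rfl⟩

/-- The isthmus: the matroid of rank one on a single point. -/
def isthmus : Matroid Unit := Matroid.freeOn Set.univ

/-! ### Parallel connections -/

section Parallel

variable {α : Type u} {β : Type v}

/-- The equivalence relation on the disjoint union whose only nontrivial class is `{x, y}`. -/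
def glue (x : α) (y : β) : Setoid (α ⊕ β) where
  r a b := a = b ∨ (a = Sum.inl x ∧ b = Sum.inr y) ∨ (a = Sum.inr y ∧ b = Sum.inl x)
  iseqv := by
    refine ⟨fun a => Or.inl rfl, ?_, ?_⟩
    · rintro a b (h | h | h)
      · exact Or.inl h.symm
      · exact Or.inr (Or.inr h.symm)
      · exact Or.inr (Or.inl h.symm)
    · rintro a b c (rfl | ⟨rfl, rfl⟩ | ⟨rfl, rfl⟩) h
      · exact h
      · rcases h with h | h | h <;> simp_all
      · rcases h with h | h | h <;> simp_all

/-- The class of a point of the first matroid. -/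
def left (x : α) (y : β) (a : α) : Quotient (glue x y) := Quotient.mk _ (Sum.inl a)

/-- The class of a point of the second matroid. -/
def right (x : α) (y : β) (b : β) : Quotient (glue x y) := Quotient.mk _ (Sum.inr b)

/-- The circuits of the parallel connection of `M` and `N` along `x` and `y`: the circuits of `M`,
the circuits of `N`, and the sets `(C - x) ∪ (C' - y)` with `x ∈ C` a circuit of `M` and `y ∈ C'`
a circuit of `N`. -/
def parallelCircuits (M : Matroid α) (N : Matroid β) (x : α) (y : β) :
    Set (Set (Quotient (glue x y))) :=
  {D | ∃ C, M.IsCircuit C ∧ D = left x y '' C} ∪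
  {D | ∃ C', N.IsCircuit C' ∧ D = right x y '' C'} ∪
  {D | ∃ C C', M.IsCircuit C ∧ x ∈ C ∧ N.IsCircuit C' ∧ y ∈ C' ∧
    D = left x y '' (C \ {x}) ∪ right x y '' (C' \ {y})}

/-- `P` is the parallel connection of `M` and `N` that identifies the point `x` of `M` with the
point `y` of `N`: the matroid on the classes of points with the circuits above. -/
structure IsParallelConnection (M : Matroid α) (N : Matroid β) (x : α) (y : β)
    (P : Matroid (Quotient (glue x y))) : Prop where
  left_mem : x ∈ M.E
  right_mem : y ∈ N.E
  ground_eq : P.E = left x y '' M.E ∪ right x y '' N.E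
  isCircuit_iff : ∀ D, P.IsCircuit D ↔ D ∈ parallelCircuits M N x y

end Parallel

/-- A parallel connection is determined by the two matroids and the two points. -/
theorem IsParallelConnection.unique {α : Type u} {β : Type v} {x : α} {y : β}
    {P Q : Matroid (Quotient (glue x y))} {M : Matroid α} {N : Matroid β}
    (hP : IsParallelConnection M N x y P) (hQ : IsParallelConnection M N x y Q) : P = Q :=
  Matroid.ext_isCircuit (hP.ground_eq.trans hQ.ground_eq.symm)
    fun C _ => (hP.isCircuit_iff C).trans (hQ.isCircuit_iff C).symm

/-! ### The fan graphs -/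

/-- The graph `G_m` on the vertices `0, …, 2m - 1` with the edges `{i, i + 1}` for
`1 ≤ i < 2m - 1` and `{0, i}` for `1 ≤ i < 2m`. -/
def fanGraph (m : ℕ) : SimpleGraph (Fin (2 * m)) :=
  SimpleGraph.fromRel fun a b =>
    (1 ≤ (a : ℕ) ∧ (b : ℕ) = a + 1) ∨ ((a : ℕ) = 0 ∧ 1 ≤ (b : ℕ))

/-- The edge `{0, m + k}` of `G_m`, for `0 ≤ k < m`. -/
def spoke (m : ℕ) (k : Fin m) : Sym2 (Fin (2 * m)) :=
  s(⟨0, by have := k.isLt; omega⟩, ⟨m + k, by have := k.isLt; omega⟩)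

end OSMatroid

end

/-!
The Orlik-Solomon algebra is insensitive to the point along which a parallel connection is formed,
once an isthmus is added. Boundaries of monomials are products of differences of generators
(`boundary_monomial_cons`), so the ideal of relations only sees these differences. For a parallel
connection `P` of `M` and `N` along `x` and `y`, the relations from the mixed circuits follow from
those of `M` and `N` (`boundary_monomial_append`). Hence the algebras of `P ⊕ S` and `M ⊕ N` have
the same relations up to the linear change of generators which fixes the generators of `M`, sends
a generator `e_b` of `N` to `e_b - e_y + e_x`, and sends the isthmus to `e_y`: it preserves the
differences inside `M` and inside `N`. So `A(P ⊕ S) ≅ A(M ⊕ N)` whatever `x` and `y` are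
(`osIsomorphic_parallelConnection_sum_isthmus`), and all the algebras of the theorem are
isomorphic to that of the direct sum of the `n`-cycle and the fan.

The matroids are told apart by the sizes of their small circuits at the identified point. As
`n > 2m + 1`, the circuits of the fan have fewer than `n` elements and the mixed circuits more than
`n`, so the `n`-cycle is the only circuit of size `n`. The circuits of size less than `n` that
meet it are the circuits of the fan through the identified spoke `{0, i}`; by a cut argument these
are the cycles through the hub that return by another spoke (`exists_eq_fanCycle_of_isCircuit`),
and the longest of them has `i + 1` elements when `m ≤ i`. This number is an isomorphism
invariant.

Existence of the parallel connection with a cycle is shown by describing its independent sets: the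
path obtained from the cycle by deleting its base point acts as a second copy of the base point
(`pathExtension`).
-/

noncomputable section

namespace OSMatroid

universe u v w

/-! ### Boundaries of monomials in the exterior algebra -/

section Boundary

variable {R : Type w} [CommRing R] {E : Type u} {F : Type v}

theorem gen_mul_self (a : E) : gen R a * gen R a = 0 :=
  ExteriorAlgebra.ι_sq_zero _

theorem gen_mul_gen_comm (a b : E) : gen R a * gen R b = -(gen R b * gen R a) := by
  rw [eq_neg_iff_add_eq_zero]
  exact ExteriorAlgebra.ι_add_mul_swap _ _

theorem monomial_cons (a : E) (l : List E) : monomial R (a :: l) = gen R a * monomial R l := by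
  simp [monomial]

theorem monomial_append (l l' : List E) :
    monomial R (l ++ l') = monomial R l * monomial R l' := by
  simp [monomial]

theorem boundary_one : boundary R E 1 = 0 :=
  CliffordAlgebra.contractLeft_one ..

theorem boundary_gen_mul (a : E) (x : FreeExterior R E) :
    boundary R E (gen R a * x) = x - gen R a * boundary R E x := by
  unfold boundary gen ExteriorAlgebra.ι
  rw [CliffordAlgebra.contractLeft_ι_mul]
  simp

theorem boundary_monomial_mul (l : List E) (x : FreeExterior R E) :
    boundary R E (monomial R l * x) = boundary R E (monomial R l) * x +
      (-1 : R) ^ l.length • (monomial R l * boundary R E x) := by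
  induction l with
  | nil => simp [monomial, boundary_one]
  | cons a l ih =>
    simp only [monomial_cons, mul_assoc, boundary_gen_mul, ih, List.length_cons, pow_succ, mul_add,
      sub_mul, mul_neg, mul_one, neg_smul, mul_smul_comm]
    abel

/-- The boundary of a monomial is a product of differences of generators, so that it only depends
on these differences. -/
theorem boundary_monomial_cons (a : E) (l : List E) :
    boundary R E (monomial R (a :: l)) = (l.map fun i => gen R i - gen R a).prod := by
  have h1 : gen R a * monomial R l = gen R a * (l.map fun i => gen R i - gen R a).prod := by
    induction l with
    | nil => simp [monomial]
    | cons b l ih =>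
      simp only [monomial_cons, List.map_cons, List.prod_cons]
      rw [← mul_assoc, gen_mul_gen_comm, neg_mul, mul_assoc, ih, ← mul_assoc (gen R a) (_ - _),
        mul_sub, gen_mul_self, sub_zero, gen_mul_gen_comm a b, neg_mul, mul_assoc]
  have h2 : boundary R E (l.map fun i => gen R i - gen R a).prod = 0 := by
    clear h1
    induction l with
    | nil => simp [boundary_one]
    | cons b l ih => simp [sub_mul, boundary_gen_mul, ih]
  rw [monomial_cons, h1, boundary_gen_mul, h2, mul_zero, sub_zero]

theorem map_boundary_monomial {ι : Type*} (L : (E →₀ R) →ₗ[R] (F →₀ R)) (g : ι → E) (h : ι → F)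
    (hL : ∀ i j, L (Finsupp.single (g i) 1) - L (Finsupp.single (g j) 1) =
      Finsupp.single (h i) 1 - Finsupp.single (h j) 1) (l : List ι) :
    ExteriorAlgebra.map L (boundary R E (monomial R (l.map g))) =
      boundary R F (monomial R (l.map h)) := by
  cases l with
  | nil => simp [monomial, boundary_one]
  | cons a l =>
    simp only [List.map_cons, boundary_monomial_cons, map_list_prod, List.map_map]
    congr 1
    refine List.map_congr_left fun i _ => ?_
    have h := hL i a
    rw [← map_sub] at h
    simp [gen, ← map_sub, h]

theorem monomial_perm {l l' : List E} (h : l.Perm l') :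
    monomial R l = monomial R l' ∨ monomial R l = -monomial R l' := by
  induction h with
  | nil => exact Or.inl rfl
  | cons a _ ih =>
    simp only [monomial_cons]
    rcases ih with ih | ih <;> simp [ih]
  | swap a b l =>
    right
    simp only [monomial_cons, ← mul_assoc, gen_mul_gen_comm b a, neg_mul]
  | trans _ _ ih ih' =>
    rcases ih with ih | ih <;> rcases ih' with ih' | ih' <;> simp [ih, ih']

/-- The boundary of the concatenation of `l` and `l'`, expressed by the boundaries of `a :: l` and
`a :: l'`: the reason why the mixed circuits of a parallel connection give no new relations. -/
theorem boundary_monomial_append (a : E) (l l' : List E) :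
    boundary R E (monomial R (l ++ l')) =
      boundary R E (monomial R l) * boundary R E (monomial R (a :: l')) +
      (-1 : R) ^ l.length •
        (boundary R E (monomial R (a :: l)) * boundary R E (monomial R l')) := by
  have hcomm : gen R a * monomial R l = (-1 : R) ^ l.length • (monomial R l * gen R a) := by
    induction l with
    | nil => simp [monomial]
    | cons b l ih =>
      rw [monomial_cons, ← mul_assoc, gen_mul_gen_comm, neg_mul, mul_assoc, ih, List.length_cons,
        pow_succ]
      simp [mul_assoc]
  have h1 : boundary R E (gen R a) = 1 := by
    simpa [boundary_one] using boundary_gen_mul (R := R) a 1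
  have h3 : gen R a * boundary R E (monomial R l) =
      -((-1 : R) ^ l.length • (boundary R E (monomial R l) * gen R a)) := by
    have h4 := boundary_gen_mul (R := R) a (monomial R l)
    rw [hcomm, map_smul, boundary_monomial_mul, h1, mul_one, smul_add, smul_smul,
      ← mul_pow, neg_one_mul, neg_neg, one_pow, one_smul] at h4
    rw [eq_sub_iff_add_eq, add_right_comm, add_eq_right] at h4
    exact eq_neg_of_add_eq_zero_right h4
  rw [monomial_append, boundary_monomial_mul, monomial_cons, monomial_cons, boundary_gen_mul,
    boundary_gen_mul, h3]
  simp only [mul_sub, sub_mul, neg_mul, smul_mul_assoc, smul_sub, smul_neg, smul_smul, ← mul_pow,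
    mul_neg, mul_one, neg_neg, one_pow, one_smul, mul_assoc]
  abel

end Boundary

/-! ### Isomorphisms of Orlik-Solomon algebras -/

section OSIso

variable {R : Type w} [CommRing R] {α : Type u} {β : Type v}

theorem OSIsomorphic.symm {M : Matroid α} {N : Matroid β} (h : OSIsomorphic R M N) :
    OSIsomorphic R N M := by
  obtain ⟨f, hf⟩ := h
  refine ⟨f.symm, fun p => ?_⟩
  rw [← hf p, ← Submodule.map_comp]
  convert Submodule.map_id _
  ext x
  simp

theorem OSIsomorphic.trans {γ : Type*} {M : Matroid α} {N : Matroid β} {P : Matroid γ}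
    (h : OSIsomorphic R M N) (h' : OSIsomorphic R N P) : OSIsomorphic R M P := by
  obtain ⟨f, hf⟩ := h
  obtain ⟨g, hg⟩ := h'
  refine ⟨f.trans g, fun p => ?_⟩
  rw [← hg p, ← hf p, ← Submodule.map_comp]
  rfl

/-- A linear change of generators that maps the relations of either algebra to relations of the
other one induces a graded isomorphism. -/
theorem osIsomorphic_of_linearEquiv {M : Matroid α} {N : Matroid β}
    (L : (M.E →₀ R) ≃ₗ[R] (N.E →₀ R))
    (hMN : ∀ x ∈ circuitBoundaries R M, ExteriorAlgebra.map L.toLinearMap x ∈ osIdeal R N)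
    (hNM : ∀ x ∈ circuitBoundaries R N, ExteriorAlgebra.map L.symm.toLinearMap x ∈ osIdeal R M) :
    OSIsomorphic R M N := by
  let Φ := ExteriorAlgebra.map L.toLinearMap
  let Ψ := ExteriorAlgebra.map L.symm.toLinearMap
  have hΦΨ : Φ.comp Ψ = AlgHom.id R _ := by
    rw [ExteriorAlgebra.map_comp_map, L.comp_symm, ExteriorAlgebra.map_id]
  have hΨΦ : Ψ.comp Φ = AlgHom.id R _ := by
    rw [ExteriorAlgebra.map_comp_map, L.symm_comp, ExteriorAlgebra.map_id]
  let e : FreeExterior R M.E ≃ₐ[R] FreeExterior R N.E := AlgEquiv.ofAlgHom Φ Ψ hΦΨ hΨΦ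
  have h1 : osIdeal R M ≤ (osIdeal R N).comap Φ :=
    TwoSidedIdeal.span_le.2 fun x hx => (TwoSidedIdeal.mem_comap Φ).2 (hMN x hx)
  have h2 : osIdeal R N ≤ (osIdeal R M).comap Ψ :=
    TwoSidedIdeal.span_le.2 fun x hx => (TwoSidedIdeal.mem_comap Ψ).2 (hNM x hx)
  have hc : (osIdeal R M).ringCon = (osIdeal R N).ringCon.comap (e : _ ≃ₐ[R] _) := by
    ext x y
    rw [RingCon.comap_rel, TwoSidedIdeal.rel_iff, TwoSidedIdeal.rel_iff]
    change _ ↔ Φ x - Φ y ∈ _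
    rw [← map_sub]
    refine ⟨fun h => (TwoSidedIdeal.mem_comap Φ).1 (h1 h), fun h => ?_⟩
    have := (TwoSidedIdeal.mem_comap Ψ).1 (h2 h)
    rwa [← AlgHom.comp_apply, hΨΦ] at this
  refine ⟨RingCon.congrₐ R e hc, fun p => ?_⟩
  unfold osDegree
  rw [← Submodule.map_comp]
  have h3 : (⋀[R]^p (N.E →₀ R)) = (⋀[R]^p (M.E →₀ R)).map Φ.toLinearMap := by
    change _ ^ p = (_ ^ p : Submodule R _).map _
    rw [Submodule.map_pow]
    congr 1
    rw [← LinearMap.range_comp]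
    have h4 : Φ.toLinearMap ∘ₗ ExteriorAlgebra.ι R =
        ExteriorAlgebra.ι R ∘ₗ (L : (M.E →₀ R) →ₗ[R] (N.E →₀ R)) := by
      ext x; simp [Φ]
    rw [h4, LinearMap.range_comp, LinearEquiv.range, Submodule.map_top]
  rw [h3, ← Submodule.map_comp]
  rfl

end OSIso

/-! ### Circuits of direct sums -/

theorem sum_isCircuit_iff {α : Type u} {β : Type v} (M : Matroid α) (N : Matroid β)
    (D : Set (α ⊕ β)) : (M.sum N).IsCircuit D ↔
      (∃ C, M.IsCircuit C ∧ D = Sum.inl '' C) ∨ ∃ C, N.IsCircuit C ∧ D = Sum.inr '' C := by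
  have hl : ∀ C, (M.sum N).Dep (Sum.inl '' C) ↔ M.Dep C := fun C => by
    simp [Matroid.Dep, Set.preimage_image_eq _ Sum.inl_injective, Set.image_subset_iff,
      Set.preimage_union]
  have hr : ∀ C, (M.sum N).Dep (Sum.inr '' C) ↔ N.Dep C := fun C => by
    simp [Matroid.Dep, Set.preimage_image_eq _ Sum.inr_injective, Set.image_subset_iff,
      Set.preimage_union]
  have hcl : ∀ C, M.IsCircuit C → (M.sum N).IsCircuit (Sum.inl '' C) := by
    intro C hC
    rw [Matroid.isCircuit_iff] at hC ⊢
    refine ⟨(hl C).2 hC.1, fun D hD hDC => ?_⟩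
    obtain ⟨D, hDC', rfl⟩ := Set.subset_image_iff.1 hDC
    rw [hC.2 ((hl D).1 hD) hDC']
  have hcr : ∀ C, N.IsCircuit C → (M.sum N).IsCircuit (Sum.inr '' C) := by
    intro C hC
    rw [Matroid.isCircuit_iff] at hC ⊢
    refine ⟨(hr C).2 hC.1, fun D hD hDC => ?_⟩
    obtain ⟨D, hDC', rfl⟩ := Set.subset_image_iff.1 hDC
    rw [hC.2 ((hr D).1 hD) hDC']
  constructor
  · intro hD
    have h := hD.not_indep
    have hE := hD.subset_ground
    rw [Matroid.sum_indep_iff, not_and_or] at h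
    rcases h with h | h
    · have : M.Dep (Sum.inl ⁻¹' D) := ⟨h, fun a ha => by simpa using hE ha⟩
      obtain ⟨C, hCD, hC⟩ := this.exists_isCircuit_subset
      exact Or.inl ⟨C, hC, ((hcl C hC).eq_of_subset_isCircuit hD
        (Set.image_subset_iff.2 hCD)).symm⟩
    · have : N.Dep (Sum.inr ⁻¹' D) := ⟨h, fun a ha => by simpa using hE ha⟩
      obtain ⟨C, hCD, hC⟩ := this.exists_isCircuit_subset
      exact Or.inr ⟨C, hC, ((hcr C hC).eq_of_subset_isCircuit hD
        (Set.image_subset_iff.2 hCD)).symm⟩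
  · rintro (⟨C, hC, rfl⟩ | ⟨C, hC, rfl⟩)
    exacts [hcl C hC, hcr C hC]

theorem not_isCircuit_isthmus (C : Set Unit) : ¬ isthmus.IsCircuit C := fun h =>
  h.not_indep (by simp [isthmus])

theorem sum_isthmus_isCircuit_iff {α : Type u} (P : Matroid α) (D : Set (α ⊕ Unit)) :
    (P.sum isthmus).IsCircuit D ↔ ∃ C, P.IsCircuit C ∧ D = Sum.inl '' C := by
  rw [sum_isCircuit_iff]
  simp [not_isCircuit_isthmus]

/-! ### The Orlik-Solomon algebra of a parallel connection with an isthmus -/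

section ParallelOS

variable {R : Type w} [CommRing R] {α : Type u} {β : Type v} {x : α} {y : β}

theorem left_eq_right (x : α) (y : β) : left x y x = right x y y :=
  Quotient.sound (Or.inr (Or.inl ⟨rfl, rfl⟩))

theorem left_injective (x : α) (y : β) : Function.Injective (left x y) := fun a b h => by
  have : (Sum.inl a : α ⊕ β) = Sum.inl b ∨ _ ∨ _ := Quotient.exact h
  simpa using this

theorem right_injective (x : α) (y : β) : Function.Injective (right x y) := fun a b h => by
  have : (Sum.inr a : α ⊕ β) = Sum.inr b ∨ _ ∨ _ := Quotient.exact h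
  simpa using this

theorem left_eq_right_iff {a : α} {b : β} : left x y a = right x y b ↔ a = x ∧ b = y := by
  constructor
  · intro h
    have : (Sum.inl a : α ⊕ β) = Sum.inr b ∨ _ ∨ _ := Quotient.exact h
    simpa using this
  · rintro ⟨rfl, rfl⟩
    exact left_eq_right _ _

theorem exists_list {E S : Set α} (hS : S.Finite) (hSE : S ⊆ E) :
    ∃ l : List E, l.Nodup ∧ Subtype.val '' {i | i ∈ l} = S := by
  have h : (Subtype.val ⁻¹' S : Set E).Finite := hS.preimage Subtype.val_injective.injOn
  refine ⟨h.toFinset.toList, Finset.nodup_toList _, ?_⟩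
  ext a
  simpa using fun ha => hSE ha

theorem image_val_mem_cons {E : Set α} (a : E) (l : List E) :
    Subtype.val '' {i | i ∈ a :: l} = insert (a : α) (Subtype.val '' {i | i ∈ l}) := by
  rw [← Set.image_insert_eq]
  congr 1
  ext i
  simp

theorem boundary_monomial_map_mem_osIdeal {ι γ : Type*} {Q : Matroid γ} {g : ι → Q.E}
    (hg : Function.Injective g) {l : List ι} (hl : l.Nodup)
    (hC : Q.IsCircuit ((fun i => (g i : γ)) '' {i | i ∈ l})) :
    boundary R Q.E (monomial R (l.map g)) ∈ osIdeal R Q := by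
  refine TwoSidedIdeal.subset_span ⟨l.map g, hl.map hg, ?_, rfl⟩
  convert hC using 1
  ext e
  simp

theorem boundary_monomial_append_mem {E : Type*} {J : TwoSidedIdeal (FreeExterior R E)} (a : E)
    {l l' : List E} (h : boundary R E (monomial R (a :: l)) ∈ J)
    (h' : boundary R E (monomial R (a :: l')) ∈ J) :
    boundary R E (monomial R (l ++ l')) ∈ J := by
  rw [boundary_monomial_append a, Algebra.smul_def]
  exact J.add_mem (J.mul_mem_left _ _ h') (J.mul_mem_left _ _ (J.mul_mem_right _ _ h))

theorem boundary_monomial_mem_of_perm {E : Type*} {J : TwoSidedIdeal (FreeExterior R E)}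
    {l l' : List E} (hl : l.Perm l') (h : boundary R E (monomial R l') ∈ J) :
    boundary R E (monomial R l) ∈ J := by
  rcases monomial_perm (R := R) hl with h1 | h1
  · rwa [h1]
  · rw [h1, map_neg]
    exact J.neg_mem h

/-- The Orlik-Solomon algebra of the direct sum of a parallel connection and an isthmus does not
depend on the points that are identified: it is the algebra of the direct sum of the two
matroids. -/
theorem osIsomorphic_parallelConnection_sum_isthmus {M : Matroid α} {N : Matroid β}
    {P : Matroid (Quotient (glue x y))} (hP : IsParallelConnection M N x y P) :
    OSIsomorphic R (P.sum isthmus) (M.sum N) := by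
  have hgM : ∀ a ∈ M.E, Sum.inl (left x y a) ∈ (P.sum isthmus).E := fun a ha => by
    simpa [hP.ground_eq] using Or.inl ⟨a, ha, rfl⟩
  have hgN : ∀ b ∈ N.E, Sum.inl (right x y b) ∈ (P.sum isthmus).E := fun b hb => by
    simpa [hP.ground_eq] using Or.inr ⟨b, hb, rfl⟩
  let gM : M.E → (P.sum isthmus).E := fun a => ⟨Sum.inl (left x y a), hgM a a.2⟩
  let gN : N.E → (P.sum isthmus).E := fun b => ⟨Sum.inl (right x y b), hgN b b.2⟩
  let s : (P.sum isthmus).E := ⟨Sum.inr (), by simp [isthmus]⟩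
  let hM : M.E → (M.sum N).E := fun a => ⟨Sum.inl a, by simp⟩
  let hN : N.E → (M.sum N).E := fun b => ⟨Sum.inr b, by simp⟩
  let x₀ : M.E := ⟨x, hP.left_mem⟩
  let y₀ : N.E := ⟨y, hP.right_mem⟩
  have gM_inj : Function.Injective gM := fun a b h =>
    Subtype.ext (left_injective x y (by simpa [gM] using h))
  have gN_inj : Function.Injective gN := fun a b h =>
    Subtype.ext (right_injective x y (by simpa [gN] using h))
  have hM_inj : Function.Injective hM := fun a b h =>
    Subtype.ext (by simpa [hM] using h)
  have hN_inj : Function.Injective hN := fun a b h =>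
    Subtype.ext (by simpa [hN] using h)
  have gMN : ∀ {a b}, gM a = gN b ↔ a = x₀ ∧ b = y₀ := fun {a b} => by
    simp [gM, gN, x₀, y₀, left_eq_right_iff, Subtype.ext_iff]
  have hE : ∀ e, (∃ a, e = gM a) ∨ (∃ b, e = gN b) ∨ e = s := by
    rintro ⟨e | e, he⟩
    · have : e ∈ left x y '' M.E ∪ right x y '' N.E := by simpa [hP.ground_eq] using he
      rcases this with ⟨a, ha, rfl⟩ | ⟨b, hb, rfl⟩
      exacts [Or.inl ⟨⟨a, ha⟩, rfl⟩, Or.inr (Or.inl ⟨⟨b, hb⟩, rfl⟩)]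
    · exact Or.inr (Or.inr rfl)
  have hE' : ∀ e, (∃ a, e = hM a) ∨ ∃ b, e = hN b := by
    rintro ⟨e | e, he⟩
    · exact Or.inl ⟨⟨e, by simpa using he⟩, rfl⟩
    · exact Or.inr ⟨⟨e, by simpa using he⟩, rfl⟩
  -- The change of generators: differences of points of `M` and of `N` are preserved, and the two
  -- remaining degrees of freedom are matched by sending the isthmus to the point `y` of `N`.
  obtain ⟨v, vM, vN, vs⟩ : ∃ v : (P.sum isthmus).E → ((M.sum N).E →₀ R),
      (∀ a, v (gM a) = Finsupp.single (hM a) 1) ∧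
      (∀ b, v (gN b) = Finsupp.single (hN b) 1 - Finsupp.single (hN y₀) 1 +
        Finsupp.single (hM x₀) 1) ∧ v s = Finsupp.single (hN y₀) 1 := by
    classical
    refine ⟨fun e => if h : ∃ a, gM a = e then Finsupp.single (hM h.choose) 1 else
      if h : ∃ b, gN b = e then Finsupp.single (hN h.choose) 1 - Finsupp.single (hN y₀) 1 +
        Finsupp.single (hM x₀) 1 else Finsupp.single (hN y₀) 1, fun a => ?_, fun b => ?_, ?_⟩
    · have h : ∃ a', gM a' = gM a := ⟨a, rfl⟩
      simp only [dif_pos h]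
      rw [gM_inj h.choose_spec]
    · by_cases h : ∃ a, gM a = gN b
      · simp only [dif_pos h]
        rw [(gMN.1 h.choose_spec).1, (gMN.1 h.choose_spec).2, sub_self, zero_add]
      · have h' : ∃ b', gN b' = gN b := ⟨b, rfl⟩
        simp only [dif_neg h, dif_pos h']
        rw [gN_inj h'.choose_spec]
    · simp [gM, gN, s]
  obtain ⟨u, uM, uN⟩ : ∃ u : (M.sum N).E → ((P.sum isthmus).E →₀ R),
      (∀ a, u (hM a) = Finsupp.single (gM a) 1) ∧
      (∀ b, u (hN b) = Finsupp.single (gN b) 1 - Finsupp.single (gN y₀) 1 +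
        Finsupp.single s 1) := by
    refine ⟨fun e => match e with
      | ⟨Sum.inl a, h⟩ => Finsupp.single (gM ⟨a, by simpa using h⟩) 1
      | ⟨Sum.inr b, h⟩ => Finsupp.single (gN ⟨b, by simpa using h⟩) 1 -
          Finsupp.single (gN y₀) 1 + Finsupp.single s 1, fun a => rfl, fun b => rfl⟩
  have hxy : gM x₀ = gN y₀ := gMN.2 ⟨rfl, rfl⟩
  let V := Finsupp.linearCombination R v
  let U := Finsupp.linearCombination R u
  have hV : ∀ e, V (Finsupp.single e 1) = v e := fun e => by simp [V]
  have hU : ∀ e, U (Finsupp.single e 1) = u e := fun e => by simp [U]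
  have hVU : V ∘ₗ U = LinearMap.id := by
    refine Finsupp.lhom_ext' fun e => LinearMap.ext_ring ?_
    change V (U (Finsupp.single e 1)) = Finsupp.single e 1
    rcases hE' e with ⟨a, rfl⟩ | ⟨b, rfl⟩
    · rw [hU, uM, hV, vM]
    · rw [hU, uN, map_add, map_sub, hV, hV, hV, vN, vN, vs]
      abel
  have hUV : U ∘ₗ V = LinearMap.id := by
    refine Finsupp.lhom_ext' fun e => LinearMap.ext_ring ?_
    change U (V (Finsupp.single e 1)) = Finsupp.single e 1
    rcases hE e with ⟨a, rfl⟩ | ⟨b, rfl⟩ | rfl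
    · rw [hV, vM, hU, uM]
    · rw [hV, vN, map_add, map_sub, hU, hU, hU, uN, uN, uM, hxy]
      abel
    · rw [hV, vs, hU, uN]
      abel
  let L : ((P.sum isthmus).E →₀ R) ≃ₗ[R] ((M.sum N).E →₀ R) := LinearEquiv.ofLinearMap V U hVU hUV
  -- The circuits of `M` and of `N` give relations in both algebras.
  have relM : ∀ l : List M.E, l.Nodup → M.IsCircuit (Subtype.val '' {i | i ∈ l}) →
      boundary R _ (monomial R (l.map gM)) ∈ osIdeal R (P.sum isthmus) := fun l hl hC => by
    refine boundary_monomial_map_mem_osIdeal gM_inj hl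
      ((sum_isthmus_isCircuit_iff P _).2 ⟨left x y '' (Subtype.val '' {i | i ∈ l}), ?_, ?_⟩)
    · exact (hP.isCircuit_iff _).2 (Or.inl (Or.inl ⟨_, hC, rfl⟩))
    · simp only [gM, Set.image_image]
  have relN : ∀ l : List N.E, l.Nodup → N.IsCircuit (Subtype.val '' {i | i ∈ l}) →
      boundary R _ (monomial R (l.map gN)) ∈ osIdeal R (P.sum isthmus) := fun l hl hC => by
    refine boundary_monomial_map_mem_osIdeal gN_inj hl
      ((sum_isthmus_isCircuit_iff P _).2 ⟨right x y '' (Subtype.val '' {i | i ∈ l}), ?_, ?_⟩)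
    · exact (hP.isCircuit_iff _).2 (Or.inl (Or.inr ⟨_, hC, rfl⟩))
    · simp only [gN, Set.image_image]
  have relM' : ∀ l : List M.E, l.Nodup → M.IsCircuit (Subtype.val '' {i | i ∈ l}) →
      boundary R _ (monomial R (l.map hM)) ∈ osIdeal R (M.sum N) := fun l hl hC =>
    boundary_monomial_map_mem_osIdeal hM_inj hl ((sum_isCircuit_iff M N _).2
      (Or.inl ⟨_, hC, by simp only [hM, Set.image_image]⟩))
  have relN' : ∀ l : List N.E, l.Nodup → N.IsCircuit (Subtype.val '' {i | i ∈ l}) →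
      boundary R _ (monomial R (l.map hN)) ∈ osIdeal R (M.sum N) := fun l hl hC =>
    boundary_monomial_map_mem_osIdeal hN_inj hl ((sum_isCircuit_iff M N _).2
      (Or.inr ⟨_, hC, by simp only [hN, Set.image_image]⟩))
  -- Conversely, the relations from these circuits imply those from the mixed circuits.
  have key : ∀ J : TwoSidedIdeal (FreeExterior R (P.sum isthmus).E),
      (∀ l : List M.E, l.Nodup → M.IsCircuit (Subtype.val '' {i | i ∈ l}) →
        boundary R _ (monomial R (l.map gM)) ∈ J) →
      (∀ l : List N.E, l.Nodup → N.IsCircuit (Subtype.val '' {i | i ∈ l}) →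
        boundary R _ (monomial R (l.map gN)) ∈ J) →
      ∀ z ∈ circuitBoundaries R (P.sum isthmus), z ∈ J := by
    rintro J hJM hJN _ ⟨l, hl, hlC, rfl⟩
    obtain ⟨D, hD, hlD⟩ := (sum_isthmus_isCircuit_iff P _).1 hlC
    have hmem : ∀ e, e ∈ l ↔ (e : Quotient (glue x y) ⊕ Unit) ∈ Sum.inl '' D := fun e => by
      rw [← hlD, Subtype.val_injective.mem_set_image, Set.mem_ofPred_eq]
    have hDfin : D.Finite := by
      refine Set.Finite.of_finite_image ?_ (Sum.inl_injective (β := Unit)).injOn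
      rw [← hlD]
      exact l.finite_toSet.image _
    have hgM' : ∀ (l : List M.E) e, e ∈ l.map gM ↔ (e : Quotient (glue x y) ⊕ Unit) ∈
        Sum.inl '' (left x y '' (Subtype.val '' {i | i ∈ l})) := fun l e => by
      simp [gM, Subtype.ext_iff]
    have hgN' : ∀ (l : List N.E) e, e ∈ l.map gN ↔ (e : Quotient (glue x y) ⊕ Unit) ∈
        Sum.inl '' (right x y '' (Subtype.val '' {i | i ∈ l})) := fun l e => by
      simp [gN, Subtype.ext_iff]
    rcases (hP.isCircuit_iff D).1 hD with (⟨C, hC, rfl⟩ | ⟨C, hC, rfl⟩) |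
      ⟨C, C', hC, hxC, hC', hyC', rfl⟩
    · obtain ⟨l', hl', hlC'⟩ := exists_list (hDfin.of_finite_image (left_injective x y).injOn)
        hC.subset_ground
      refine boundary_monomial_mem_of_perm ?_ (hJM l' hl' (hlC' ▸ hC))
      rw [List.perm_ext_iff_of_nodup hl (hl'.map gM_inj)]
      intro e
      rw [hmem, hgM', hlC']
    · obtain ⟨l', hl', hlC'⟩ := exists_list (hDfin.of_finite_image (right_injective x y).injOn)
        hC.subset_ground
      refine boundary_monomial_mem_of_perm ?_ (hJN l' hl' (hlC' ▸ hC))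
      rw [List.perm_ext_iff_of_nodup hl (hl'.map gN_inj)]
      intro e
      rw [hmem, hgN', hlC']
    · rw [Set.finite_union] at hDfin
      obtain ⟨l₁, hl₁, hlC₁⟩ := exists_list
        (hDfin.1.of_finite_image (left_injective x y).injOn)
        (Set.sdiff_subset.trans hC.subset_ground)
      obtain ⟨l₂, hl₂, hlC₂⟩ := exists_list
        (hDfin.2.of_finite_image (right_injective x y).injOn)
        (Set.sdiff_subset.trans hC'.subset_ground)
      have hx : x₀ ∉ l₁ := fun h => by
        have : x ∈ C \ {x} := hlC₁ ▸ ⟨x₀, h, rfl⟩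
        exact this.2 rfl
      have hy : y₀ ∉ l₂ := fun h => by
        have : y ∈ C' \ {y} := hlC₂ ▸ ⟨y₀, h, rfl⟩
        exact this.2 rfl
      have h₁ := hJM (x₀ :: l₁) (List.nodup_cons.2 ⟨hx, hl₁⟩) (by
        convert hC
        rw [image_val_mem_cons, hlC₁, Set.insert_sdiff_self_of_mem hxC])
      have h₂ := hJN (y₀ :: l₂) (List.nodup_cons.2 ⟨hy, hl₂⟩) (by
        convert hC'
        rw [image_val_mem_cons, hlC₂, Set.insert_sdiff_self_of_mem hyC'])
      rw [List.map_cons] at h₁ h₂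
      rw [← hxy] at h₂
      refine boundary_monomial_mem_of_perm ?_ (boundary_monomial_append_mem _ h₁ h₂)
      have hdisj : (l₁.map gM).Disjoint (l₂.map gN) := by
        intro e he he'
        obtain ⟨a, ha, rfl⟩ := List.mem_map.1 he
        obtain ⟨b, hb, hab⟩ := List.mem_map.1 he'
        exact hx ((gMN.1 hab.symm).1 ▸ ha)
      rw [List.perm_ext_iff_of_nodup hl ((hl₁.map gM_inj).append (hl₂.map gN_inj) hdisj)]
      intro e
      rw [hmem, List.mem_append, hgM', hgN', hlC₁, hlC₂, Set.image_union]
      rfl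
  have hVM : ∀ l : List M.E, ExteriorAlgebra.map V (boundary R _ (monomial R (l.map gM))) =
      boundary R _ (monomial R (l.map hM)) := fun l =>
    map_boundary_monomial V gM hM (fun i j => by rw [hV, hV, vM, vM]) l
  have hVN : ∀ l : List N.E, ExteriorAlgebra.map V (boundary R _ (monomial R (l.map gN))) =
      boundary R _ (monomial R (l.map hN)) := fun l =>
    map_boundary_monomial V gN hN (fun i j => by rw [hV, hV, vN, vN]; abel) l
  have hUM : ∀ l : List M.E, ExteriorAlgebra.map U (boundary R _ (monomial R (l.map hM))) =
      boundary R _ (monomial R (l.map gM)) := fun l =>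
    map_boundary_monomial U hM gM (fun i j => by rw [hU, hU, uM, uM]) l
  have hUN : ∀ l : List N.E, ExteriorAlgebra.map U (boundary R _ (monomial R (l.map hN))) =
      boundary R _ (monomial R (l.map gN)) := fun l =>
    map_boundary_monomial U hN gN (fun i j => by rw [hU, hU, uN, uN]; abel) l
  refine osIsomorphic_of_linearEquiv L (fun z hz => ?_) ?_
  · refine (TwoSidedIdeal.mem_comap (ExteriorAlgebra.map V)).1 (key _ ?_ ?_ z hz)
    · intro l hl hC
      rw [TwoSidedIdeal.mem_comap, hVM]
      exact relM' l hl hC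
    · intro l hl hC
      rw [TwoSidedIdeal.mem_comap, hVN]
      exact relN' l hl hC
  · rintro _ ⟨l, hl, hlC, rfl⟩
    change ExteriorAlgebra.map U _ ∈ _
    have hmem : ∀ {D : Set (α ⊕ β)}, Subtype.val '' {i | i ∈ l} = D →
        ∀ e, e ∈ l ↔ (e : α ⊕ β) ∈ D := fun h e => by
      rw [← h, Subtype.val_injective.mem_set_image, Set.mem_ofPred_eq]
    have hfin : (Subtype.val '' {i | i ∈ l}).Finite := l.finite_toSet.image _
    have hhM' : ∀ (l : List M.E) e, e ∈ l.map hM ↔ (e : α ⊕ β) ∈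
        Sum.inl '' (Subtype.val '' {i | i ∈ l}) := fun l e => by
      simp [hM, Subtype.ext_iff]
    have hhN' : ∀ (l : List N.E) e, e ∈ l.map hN ↔ (e : α ⊕ β) ∈
        Sum.inr '' (Subtype.val '' {i | i ∈ l}) := fun l e => by
      simp [hN, Subtype.ext_iff]
    rw [← TwoSidedIdeal.mem_comap (ExteriorAlgebra.map U)]
    rcases (sum_isCircuit_iff M N _).1 hlC with ⟨C, hC, h⟩ | ⟨C, hC, h⟩
    · rw [h] at hfin
      obtain ⟨l', hl', hlC'⟩ := exists_list (hfin.of_finite_image Sum.inl_injective.injOn)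
        hC.subset_ground
      refine boundary_monomial_mem_of_perm (l' := l'.map hM) ?_ ?_
      · rw [List.perm_ext_iff_of_nodup hl (hl'.map hM_inj)]
        intro e
        rw [hmem h, hhM', hlC']
      · rw [TwoSidedIdeal.mem_comap, hUM]
        exact relM l' hl' (hlC' ▸ hC)
    · rw [h] at hfin
      obtain ⟨l', hl', hlC'⟩ := exists_list (hfin.of_finite_image Sum.inr_injective.injOn)
        hC.subset_ground
      refine boundary_monomial_mem_of_perm (l' := l'.map hN) ?_ ?_
      · rw [List.perm_ext_iff_of_nodup hl (hl'.map hN_inj)]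
        intro e
        rw [hmem h, hhN', hlC']
      · rw [TwoSidedIdeal.mem_comap, hUN]
        exact relN l' hl' (hlC' ▸ hC)

end ParallelOS

/-! ### Parallel connections with a cycle -/

section PathExtension

variable {β : Type v} {γ : Type u} {A : Set γ} {r : β → γ} {y : β} {N : Matroid β}

/-- The independent sets of the matroid obtained from `N` by adding a path `A` parallel to the
point `y`: together, the elements of `A` behave as another copy of `y`. The points of `N` are
embedded by `r`. -/
def PathExtensionIndep (A : Set γ) (r : β → γ) (y : β) (N : Matroid β) (I : Set γ) : Prop :=
  I ⊆ A ∪ r '' N.E ∧ N.Indep (r ⁻¹' I) ∧ (A ⊆ I → r y ∉ I ∧ N.Indep (insert y (r ⁻¹' I)))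

theorem exists_insert_indep_of_ncard_lt [N.Finite] {I J : Set β} (hI : N.Indep I) (hJ : N.Indep J)
    (h : I.ncard < J.ncard) : ∃ e ∈ J, e ∉ I ∧ N.Indep (insert e I) := by
  have hIf := N.ground_finite.subset hI.subset_ground
  have hJf := N.ground_finite.subset hJ.subset_ground
  obtain ⟨e, he, h'⟩ := hI.augment hJ (by
    rw [← hIf.cast_ncard_eq, ← hJf.cast_ncard_eq]; exact_mod_cast h)
  exact ⟨e, he.1, he.2, h'⟩

theorem PathExtensionIndep.exists_insert [N.Finite] (hA : A.Finite) (hr : Function.Injective r)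
    (hAr : Disjoint A (Set.range r)) (hy : y ∈ N.E) {I J : Set γ}
    (hI : PathExtensionIndep A r y N I) (hJ : PathExtensionIndep A r y N J)
    (hlt : I.ncard < J.ncard) :
    ∃ e ∈ J, e ∉ I ∧ PathExtensionIndep A r y N (insert e I) := by
  have hrA : ∀ b, r b ∉ A := fun b hb => Set.disjoint_left.1 hAr hb ⟨b, rfl⟩
  have hNf : ∀ {K : Set β}, N.Indep K → K.Finite := fun h => N.ground_finite.subset h.subset_ground
  have hcard : ∀ K, PathExtensionIndep A r y N K →
      K.ncard = (K ∩ A).ncard + (r ⁻¹' K).ncard := by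
    intro K hK
    have h1 : K = (K ∩ A) ∪ r '' (r ⁻¹' K) := by
      ext k
      rw [Set.image_preimage_eq_inter_range]
      constructor
      · intro hk
        rcases hK.1 hk with h | ⟨b, -, rfl⟩
        exacts [Or.inl ⟨hk, h⟩, Or.inr ⟨hk, b, rfl⟩]
      · rintro (h | h)
        exacts [h.1, h.1]
    conv_lhs => rw [h1]
    rw [Set.ncard_union_eq ?_ (hA.subset Set.inter_subset_right) ((hNf hK.2.1).image _),
      Set.ncard_image_of_injective _ hr]
    exact (hAr.mono_left Set.inter_subset_right).mono_right (Set.image_subset_range _ _)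
  have hins : ∀ {b}, r ⁻¹' (insert (r b) I) = insert b (r ⁻¹' I) := fun {b} => by
    ext c; simp [hr.eq_iff]
  have hinsA : ∀ {a}, a ∈ A → r ⁻¹' (insert a I) = r ⁻¹' I := fun {a} ha => by
    ext c
    have : r c ≠ a := fun h => hrA c (h ▸ ha)
    simp [this]
  have hsub : ∀ {b}, A ⊆ insert (r b) I → A ⊆ I := fun {b} h a ha => by
    rcases h ha with rfl | h
    exacts [absurd ha (hrA b), h]
  have hinA : (I ∩ A).ncard ≤ A.ncard := Set.ncard_le_ncard Set.inter_subset_right hA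
  have hAI : ¬ A ⊆ I → (I ∩ A).ncard < A.ncard := fun h =>
    Set.ncard_lt_ncard ⟨Set.inter_subset_right, fun h' => h fun a ha => (h' ha).1⟩ hA
  have hJA : ∀ {K}, A ⊆ K → (K ∩ A).ncard = A.ncard := fun h => by
    rw [Set.inter_eq_self_of_subset_right h]
  have hins_y : ∀ {K}, PathExtensionIndep A r y N K → A ⊆ K →
      (insert y (r ⁻¹' K)).ncard = (r ⁻¹' K).ncard + 1 := fun hK h =>
    Set.ncard_insert_of_notMem (hK.2.2 h).1 (hNf hK.2.1)
  rw [hcard I hI, hcard J hJ] at hlt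
  -- A point of `N` may be added to `I` if the larger set remains independent in `N`.
  have addN : ∀ b ∈ r ⁻¹' J, b ∉ r ⁻¹' I → N.Indep (insert b (r ⁻¹' I)) →
      (A ⊆ I → b ≠ y ∧ N.Indep (insert b (insert y (r ⁻¹' I)))) →
      ∃ e ∈ J, e ∉ I ∧ PathExtensionIndep A r y N (insert e I) := by
    intro b hbJ hbI hb hby
    refine ⟨r b, hbJ, hbI, Set.insert_subset (Or.inr ⟨b, hb.subset_ground (Set.mem_insert _ _),
      rfl⟩) hI.1, hins ▸ hb, fun h => ?_⟩
    have h' := hsub h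
    refine ⟨?_, ?_⟩
    · rintro (h1 | h1)
      exacts [(hby h').1 (hr h1).symm, (hI.2.2 h').1 h1]
    · rw [hins, Set.insert_comm]
      exact (hby h').2
  by_cases hAI' : A ⊆ I
  · obtain ⟨h1, h2⟩ := hI.2.2 hAI'
    have h3 := hins_y hI hAI'
    have h4 := hJA hAI'
    by_cases hAJ : A ⊆ J
    · have h5 := hins_y hJ hAJ
      have h6 := hJA hAJ
      obtain ⟨b, hb, hbI, hbi⟩ := exists_insert_indep_of_ncard_lt h2 (hJ.2.2 hAJ).2 (by omega)
      rw [Set.mem_insert_iff, not_or] at hbI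
      exact addN b (hb.resolve_left hbI.1) hbI.2
        (hbi.subset (Set.insert_subset_insert (Set.subset_insert _ _))) fun _ => ⟨hbI.1, hbi⟩
    · have h5 : (J ∩ A).ncard < A.ncard :=
        Set.ncard_lt_ncard ⟨Set.inter_subset_right, fun h' => hAJ fun a ha => (h' ha).1⟩ hA
      obtain ⟨b, hb, hbI, hbi⟩ := exists_insert_indep_of_ncard_lt h2 hJ.2.1 (by omega)
      rw [Set.mem_insert_iff, not_or] at hbI
      exact addN b hb hbI.2
        (hbi.subset (Set.insert_subset_insert (Set.subset_insert _ _))) fun _ => ⟨hbI.1, hbi⟩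
  · by_cases hle : (J ∩ A).ncard ≤ (I ∩ A).ncard
    · obtain ⟨b, hb, hbI, hbi⟩ := exists_insert_indep_of_ncard_lt hI.2.1 hJ.2.1 (by omega)
      exact addN b hb hbI hbi fun h => absurd h hAI'
    · obtain ⟨a, haJ, haI⟩ := Set.exists_mem_notMem_of_ncard_lt_ncard (not_le.1 hle)
        (hA.subset Set.inter_subset_right)
      have haI' : a ∉ I := fun h => haI ⟨h, haJ.2⟩
      by_cases hAa : A ⊆ insert a I
      · -- `I` misses only the element `a` of the path, so that `J` contains the whole path.
        have h1 : A.ncard ≤ (I ∩ A).ncard + 1 := by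
          refine (Set.ncard_le_ncard (t := insert a (I ∩ A)) (fun e he => ?_)
            ((hA.subset Set.inter_subset_right).insert _)).trans (Set.ncard_insert_le _ _)
          rcases hAa he with h | h
          exacts [Or.inl h, Or.inr ⟨h, he⟩]
        have h2 : A ⊆ J := by
          have : J ∩ A = A := Set.eq_of_subset_of_ncard_le Set.inter_subset_right (by omega) hA
          exact Set.inter_eq_right.1 this
        have h3 := hins_y hJ h2
        have h4 := hJA h2
        have h5 := hAI hAI'
        obtain ⟨b, hb, hbI, hbi⟩ := exists_insert_indep_of_ncard_lt hI.2.1 (hJ.2.2 h2).2 (by omega)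
        rcases hb with rfl | hb
        · refine ⟨a, haJ.1, haI', Set.insert_subset (Or.inl haJ.2) hI.1, ?_, fun _ => ⟨?_, ?_⟩⟩
          · rw [hinsA haJ.2]
            exact hI.2.1
          · rintro (h | h)
            exacts [hrA b (h ▸ haJ.2), hbI h]
          · rwa [hinsA haJ.2]
        · exact addN b hb hbI hbi fun h => absurd h hAI'
      · refine ⟨a, haJ.1, haI', Set.insert_subset (Or.inl haJ.2) hI.1, ?_, fun h => absurd h hAa⟩
        rw [hinsA haJ.2]
        exact hI.2.1

/-- The matroid obtained from `N` by adding a path `A` parallel to the point `y`. -/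
def pathExtension (A : Set γ) (r : β → γ) (y : β) (N : Matroid β) [N.Finite] (hA : A.Finite)
    (hA' : A.Nonempty) (hr : Function.Injective r) (hAr : Disjoint A (Set.range r))
    (hy : y ∈ N.E) : Matroid γ :=
  (IndepMatroid.ofFinite (hA.union (N.ground_finite.image r)) (PathExtensionIndep A r y N)
    ⟨Set.empty_subset _, by simp, fun h => absurd (Set.subset_empty_iff.1 h) hA'.ne_empty⟩
    (fun _ _ hJ hIJ => ⟨hIJ.trans hJ.1, hJ.2.1.subset (Set.preimage_mono hIJ), fun h =>
      ⟨fun h' => (hJ.2.2 (h.trans hIJ)).1 (hIJ h'),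
        (hJ.2.2 (h.trans hIJ)).2.subset (Set.insert_subset_insert (Set.preimage_mono hIJ))⟩⟩)
    (fun _ _ hI hJ hlt => hI.exists_insert hA hr hAr hy hJ hlt)
    (fun _ hI => hI.1)).matroid

variable [N.Finite] {hA : A.Finite} {hA' : A.Nonempty} {hr : Function.Injective r}
  {hAr : Disjoint A (Set.range r)} {hy : y ∈ N.E}

theorem pathExtension_indep {I : Set γ} :
    (pathExtension A r y N hA hA' hr hAr hy).Indep I ↔ PathExtensionIndep A r y N I := Iff.rfl

/-- The circuits of the extension: the path closed up by `y`, the circuits of `N`, and the circuits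
of `N` through `y` with `y` replaced by the path. -/
theorem pathExtension_isCircuit_iff (hyN : N.Indep {y}) (D : Set γ) :
    (pathExtension A r y N hA hA' hr hAr hy).IsCircuit D ↔
      D = insert (r y) A ∨ (∃ C, N.IsCircuit C ∧ D = r '' C) ∨
        ∃ C, N.IsCircuit C ∧ y ∈ C ∧ D = A ∪ r '' (C \ {y}) := by
  set P := pathExtension A r y N hA hA' hr hAr hy
  have hrA : ∀ b, r b ∉ A := fun b hb => Set.disjoint_left.1 hAr hb ⟨b, rfl⟩
  have hAim : ∀ K : Set β, ¬ A ⊆ r '' K := fun K h => by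
    obtain ⟨a, ha⟩ := hA'
    obtain ⟨b, -, rfl⟩ := h ha
    exact hrA b ha
  have hpA : r ⁻¹' A = ∅ := Set.eq_empty_of_forall_notMem hrA
  have hp1 : r ⁻¹' (insert (r y) A) = {y} := by
    ext b; simp [hr.eq_iff, hrA]
  have hp2 : ∀ K : Set β, r ⁻¹' (A ∪ r '' K) = K := fun K => by
    rw [Set.preimage_union, hpA, Set.empty_union, Set.preimage_image_eq _ hr]
  have c1 : P.IsCircuit (insert (r y) A) := by
    rw [Matroid.isCircuit_iff_dep_forall_sdiff_singleton_indep]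
    refine ⟨⟨fun h => ?_, Set.insert_subset (Or.inr ⟨y, hy, rfl⟩) Set.subset_union_left⟩, ?_⟩
    · exact (h.2.2 (Set.subset_insert _ _)).1 (Set.mem_insert _ _)
    · intro e he
      refine ⟨Set.sdiff_subset.trans (Set.insert_subset (Or.inr ⟨y, hy, rfl⟩)
        Set.subset_union_left), hyN.subset ?_, fun h => ?_⟩
      · rw [← hp1]
        exact Set.preimage_mono Set.sdiff_subset
      · have : e = r y := he.resolve_right fun h' => (h h').2 rfl
        subst this
        refine ⟨fun h' => h'.2 rfl, hyN.subset (Set.insert_subset rfl ?_)⟩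
        rw [← hp1]
        exact Set.preimage_mono Set.sdiff_subset
  have c2 : ∀ C, N.IsCircuit C → P.IsCircuit (r '' C) := by
    intro C hC
    rw [Matroid.isCircuit_iff_dep_forall_sdiff_singleton_indep]
    refine ⟨⟨fun h => hC.not_indep ?_,
      (Set.image_mono hC.subset_ground).trans Set.subset_union_right⟩, ?_⟩
    · have := h.2.1
      rwa [Set.preimage_image_eq _ hr] at this
    · rintro _ ⟨b, hb, rfl⟩
      rw [← Set.image_singleton, ← Set.image_sdiff hr]
      refine ⟨(Set.image_mono (Set.sdiff_subset.trans hC.subset_ground)).trans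
        Set.subset_union_right, ?_, fun h => absurd h (hAim _)⟩
      rw [Set.preimage_image_eq _ hr]
      exact hC.sdiff_singleton_indep hb
  have c3 : ∀ C, N.IsCircuit C → y ∈ C → P.IsCircuit (A ∪ r '' (C \ {y})) := by
    intro C hC hyC
    have hsub : A ∪ r '' (C \ {y}) ⊆ A ∪ r '' N.E :=
      Set.union_subset_union_right _ (Set.image_mono (Set.sdiff_subset.trans hC.subset_ground))
    rw [Matroid.isCircuit_iff_dep_forall_sdiff_singleton_indep]
    refine ⟨⟨fun h => hC.not_indep ?_, hsub⟩, fun e he => ⟨Set.sdiff_subset.trans hsub, ?_, ?_⟩⟩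
    · have := (h.2.2 Set.subset_union_left).2
      rwa [hp2, Set.insert_sdiff_self_of_mem hyC] at this
    · refine (hC.sdiff_singleton_indep hyC).subset ?_
      conv_rhs => rw [← hp2 (C \ {y})]
      exact Set.preimage_mono Set.sdiff_subset
    · intro h
      have heA : e ∉ A := fun h' => (h h').2 rfl
      obtain ⟨b, hb, rfl⟩ := he.resolve_left heA
      refine ⟨fun h' => ?_, (hC.sdiff_singleton_indep hb.1).subset ?_⟩
      · obtain ⟨c, hc, hcy⟩ := h'.1.resolve_left (hrA y)
        exact hc.2 (hr hcy)
      · refine Set.insert_subset ⟨hyC, fun h' => hb.2 h'.symm⟩ fun c hc => ?_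
        obtain ⟨d, hd, hdc⟩ := hc.1.resolve_left (hrA c)
        obtain rfl := hr hdc
        exact ⟨hd.1, fun h' => hc.2 (congrArg r h')⟩
  constructor
  · intro hD
    have hDE : D ⊆ A ∪ r '' N.E := hD.subset_ground
    have hpE : r ⁻¹' D ⊆ N.E := fun b hb => by
      obtain ⟨c, hc, hcb⟩ := (hDE hb).resolve_left (hrA b)
      exact hr hcb ▸ hc
    have hni := hD.not_indep
    rw [pathExtension_indep, PathExtensionIndep] at hni
    by_cases h1 : N.Indep (r ⁻¹' D)
    · have h2 : A ⊆ D ∧ (r y ∉ D → ¬ N.Indep (insert y (r ⁻¹' D))) := by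
        by_contra h
        exact hni ⟨hDE, h1, fun h' => by tauto⟩
      by_cases h3 : r y ∈ D
      · exact Or.inl (c1.eq_of_subset_isCircuit hD (Set.insert_subset h3 h2.1)).symm
      · have h4 : N.Dep (insert y (r ⁻¹' D)) := ⟨h2.2 h3, Set.insert_subset hy hpE⟩
        obtain ⟨C, hCD, hC⟩ := h4.exists_isCircuit_subset
        have hyC : y ∈ C := by
          by_contra h
          exact hC.not_indep (h1.subset ((Set.subset_insert_iff_of_notMem h).1 hCD))
        refine Or.inr (Or.inr ⟨C, hC, hyC,
          ((c3 C hC hyC).eq_of_subset_isCircuit hD (Set.union_subset h2.1 ?_)).symm⟩)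
        rintro _ ⟨b, hb, rfl⟩
        exact (hCD hb.1).resolve_left hb.2
    · obtain ⟨C, hCD, hC⟩ := Matroid.Dep.exists_isCircuit_subset ⟨h1, hpE⟩
      exact Or.inr (Or.inl ⟨C, hC, ((c2 C hC).eq_of_subset_isCircuit hD
        (Set.image_subset_iff.2 hCD)).symm⟩)
  · rintro (rfl | ⟨C, hC, rfl⟩ | ⟨C, hC, hyC, rfl⟩)
    exacts [c1, c2 C hC, c3 C hC hyC]

end PathExtension

/-- A finite matroid has a parallel connection with a cycle along any point that is not a loop. -/
theorem exists_isParallelConnection_cycleMatroid {β : Type v} {n : ℕ} (hn : 2 ≤ n) {N : Matroid β}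
    [N.Finite] {y : β} (hy : N.Indep {y}) :
    ∃ P, IsParallelConnection (cycleMatroid n) N 1 y P := by
  have hyE : y ∈ N.E := by simpa using hy.subset_ground
  have hA : (left 1 y '' Set.Icc 2 n).Finite := (Set.finite_Icc 2 n).image _
  have hA' : (left 1 y '' Set.Icc 2 n).Nonempty := (Set.nonempty_Icc.2 hn).image _
  have hAr : Disjoint (left 1 y '' Set.Icc 2 n) (Set.range (right 1 y)) := by
    rw [Set.disjoint_left]
    rintro _ ⟨a, ha, rfl⟩ ⟨b, hb⟩
    have := (left_eq_right_iff.1 hb.symm).1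
    have := ha.1
    omega
  have hins : Set.Icc 1 n = insert 1 (Set.Icc 2 n) := by
    ext a; simp only [Set.mem_Icc, Set.mem_insert_iff]; omega
  have hdiff : Set.Icc 1 n \ {1} = Set.Icc 2 n := by
    ext a; simp only [Set.mem_Icc, Set.mem_sdiff, Set.mem_singleton_iff]; omega
  have himg : left 1 y '' Set.Icc 1 n = insert (right 1 y y) (left 1 y '' Set.Icc 2 n) := by
    rw [hins, Set.image_insert_eq, left_eq_right]
  refine ⟨pathExtension (left 1 y '' Set.Icc 2 n) (right 1 y) y N hA hA' (right_injective _ _) hAr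
    hyE, (⟨le_rfl, by omega⟩ : 1 ∈ Set.Icc 1 n), hyE, ?_, fun D => ?_⟩
  · have h : right 1 y y ∈ left 1 y '' Set.Icc 2 n ∪ right 1 y '' N.E := Or.inr ⟨y, hyE, rfl⟩
    change _ = left 1 y '' Set.Icc 1 n ∪ _
    rw [himg, Set.insert_union, Set.insert_eq_of_mem h]
    rfl
  · rw [pathExtension_isCircuit_iff hy]
    simp only [parallelCircuits, cycleMatroid_isCircuit_iff (show 1 ≤ n by omega), Set.mem_union,
      Set.mem_ofPred_eq, exists_eq_left, himg, or_assoc]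
    refine or_congr Iff.rfl (or_congr Iff.rfl ?_)
    constructor
    · rintro ⟨C, hC, hyC, rfl⟩
      exact ⟨_, C, rfl, ⟨le_rfl, by omega⟩, hC, hyC, by rw [hdiff]⟩
    · rintro ⟨_, C, rfl, -, hC, hyC, rfl⟩
      exact ⟨C, hC, hyC, by rw [hdiff]⟩

/-! ### Circuits of polygon matroids and cuts -/

section PolygonCircuits

variable {V : Type u} [Finite V] {G : SimpleGraph V}

theorem polygonMatroid_ground : (polygonMatroid G).E = G.edgeSet := rfl

theorem polygonMatroid_indep {I : Set (Sym2 V)} : (polygonMatroid G).Indep I ↔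
    I ⊆ G.edgeSet ∧ (SimpleGraph.fromEdgeSet I).IsAcyclic := Iff.rfl

instance : (polygonMatroid G).Finite := ⟨Set.toFinite _⟩

/-- The size of a circuit of a polygon matroid is the length of a cycle. -/
theorem three_le_ncard_le_of_isCircuit {C : Set (Sym2 V)} (hC : (polygonMatroid G).IsCircuit C) :
    3 ≤ C.ncard ∧ C.ncard ≤ Nat.card V := by
  have hCE : C ⊆ G.edgeSet := hC.subset_ground
  have h := hC.not_indep
  rw [polygonMatroid_indep, not_and] at h
  have h' := h hCE
  simp only [SimpleGraph.IsAcyclic, not_forall, not_not] at h'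
  obtain ⟨v, c, hc⟩ := h'
  have hsub : {e | e ∈ c.edges} ⊆ C := fun e he => by
    have := c.edges_subset_edgeSet he
    rw [SimpleGraph.edgeSet_fromEdgeSet] at this
    exact this.1
  have hdep : ¬ (polygonMatroid G).Indep {e | e ∈ c.edges} := by
    rw [polygonMatroid_indep, not_and]
    intro _ hac
    refine hac _ (hc.transfer (H := SimpleGraph.fromEdgeSet {e | e ∈ c.edges}) fun e he => ?_)
    rw [SimpleGraph.edgeSet_fromEdgeSet]
    exact ⟨he, (SimpleGraph.not_isDiag_of_mem_edgeSet _ (c.edges_subset_edgeSet he))⟩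
  have heq := hC.eq_of_not_indep_subset hdep hsub
  have hcard : C.ncard = c.length := by
    classical
    rw [← congrArg Set.ncard heq, ← List.coe_toFinset, Set.ncard_coe_finset,
      List.toFinset_card_of_nodup hc.isCircuit.isTrail.edges_nodup, SimpleGraph.Walk.length_edges]
  rw [hcard]
  refine ⟨hc.three_le_length, ?_⟩
  have := Fintype.ofFinite V
  rw [Nat.card_eq_fintype_card]
  have h2 := hc.support_nodup.length_le_card
  simpa using h2

/-- A circuit does not meet a cut in a single edge. -/
theorem exists_ne_mem_cut_of_isCircuit {C : Set (Sym2 V)} (hC : (polygonMatroid G).IsCircuit C)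
    {S : Set V} {a b : V} (ha : a ∈ S) (hb : b ∉ S) (hab : s(a, b) ∈ C) :
    ∃ c ∈ S, ∃ d ∉ S, s(c, d) ∈ C ∧ s(c, d) ≠ s(a, b) := by
  by_contra hcon
  push Not at hcon
  have hr : ¬ (SimpleGraph.fromEdgeSet (C \ {s(a, b)})).Reachable a b := by
    rintro ⟨p⟩
    have key : ∀ u v, (SimpleGraph.fromEdgeSet (C \ {s(a, b)})).Walk u v → u ∈ S → v ∈ S := by
      intro u v p
      induction p with
      | nil => exact id
      | cons h _ ih =>
        rw [SimpleGraph.fromEdgeSet_adj] at h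
        exact fun hu => ih (by_contra fun hv => h.1.2 (hcon _ hu _ hv h.1.1))
    exact hb (key a b p ha)
  refine hC.not_indep ⟨hC.subset_ground, ?_⟩
  have := SimpleGraph.IsAcyclic.sup_edge_of_not_reachable hr (hC.sdiff_singleton_indep hab).2
  rwa [SimpleGraph.edge, ← SimpleGraph.fromEdgeSet_union, Set.sdiff_union_self,
    Set.union_eq_self_of_subset_right (Set.singleton_subset_iff.2 hab)] at this

end PolygonCircuits

/-! ### The circuits of the fan through a spoke -/

section Fan

variable {m : ℕ}

/-- The vertex `k` of the fan graph, taken modulo `2m` so that it is defined for all `k`. -/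
def fanVertex (hm : 1 ≤ m) (k : ℕ) : Fin (2 * m) := ⟨k % (2 * m), Nat.mod_lt _ (by omega)⟩

theorem fanVertex_val (hm : 1 ≤ m) {k : ℕ} (hk : k < 2 * m) : (fanVertex hm k : ℕ) = k :=
  Nat.mod_eq_of_lt hk

theorem fanVertex_inj (hm : 1 ≤ m) {j k : ℕ} (hj : j < 2 * m) (hk : k < 2 * m) :
    fanVertex hm j = fanVertex hm k ↔ j = k := by
  rw [Fin.ext_iff, fanVertex_val hm hj, fanVertex_val hm hk]

theorem exists_fanVertex (hm : 1 ≤ m) (v : Fin (2 * m)) : ∃ k < 2 * m, v = fanVertex hm k :=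
  ⟨v, v.2, Fin.ext (fanVertex_val hm v.2).symm⟩

theorem fanEdge_eq_iff (hm : 1 ≤ m) {a b c d : ℕ} (ha : a < 2 * m) (hb : b < 2 * m)
    (hc : c < 2 * m) (hd : d < 2 * m) :
    s(fanVertex hm a, fanVertex hm b) = s(fanVertex hm c, fanVertex hm d) ↔
      a = c ∧ b = d ∨ a = d ∧ b = c := by
  rw [Sym2.eq_iff, fanVertex_inj hm ha hc, fanVertex_inj hm hb hd, fanVertex_inj hm ha hd,
    fanVertex_inj hm hb hc]

theorem fanGraph_adj (hm : 1 ≤ m) {a b : ℕ} (ha : a < 2 * m) (hb : b < 2 * m) :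
    (fanGraph m).Adj (fanVertex hm a) (fanVertex hm b) ↔ a ≠ b ∧
      ((1 ≤ a ∧ b = a + 1 ∨ a = 0 ∧ 1 ≤ b) ∨ (1 ≤ b ∧ a = b + 1 ∨ b = 0 ∧ 1 ≤ a)) := by
  rw [fanGraph, SimpleGraph.fromRel_adj, fanVertex_val hm ha, fanVertex_val hm hb, Ne,
    fanVertex_inj hm ha hb]

/-- The edges of the cycle of the fan graph through the hub `0` and the vertices `i, …, j`. -/
def fanCycle (hm : 1 ≤ m) (i j : ℕ) : Set (Sym2 (Fin (2 * m))) :=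
  insert s(fanVertex hm 0, fanVertex hm i) (insert s(fanVertex hm 0, fanVertex hm j)
    ((fun k => s(fanVertex hm k, fanVertex hm (k + 1))) '' Set.Ico i j))

theorem fanCycle_subset (hm : 1 ≤ m) {i j : ℕ} (hi : 1 ≤ i) (hij : i < j) (hj : j < 2 * m) :
    fanCycle hm i j ⊆ (fanGraph m).edgeSet := by
  refine Set.insert_subset ?_ (Set.insert_subset ?_ ?_)
  · rw [SimpleGraph.mem_edgeSet, fanGraph_adj hm (by omega) (by omega)]
    omega
  · rw [SimpleGraph.mem_edgeSet, fanGraph_adj hm (by omega) (by omega)]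
    omega
  · rintro _ ⟨k, hk, rfl⟩
    have := hk.1
    have := hk.2
    simp only
    rw [SimpleGraph.mem_edgeSet, fanGraph_adj hm (by omega) (by omega)]
    omega

theorem fanCycle_not_indep (hm : 1 ≤ m) {i j : ℕ} (hi : 1 ≤ i) (hij : i < j) (hj : j < 2 * m) :
    ¬ (polygonMatroid (fanGraph m)).Indep (fanCycle hm i j) := by
  rw [polygonMatroid_indep, not_and]
  intro _ hac
  have h0 : (SimpleGraph.fromEdgeSet (fanCycle hm i j)).Adj (fanVertex hm 0) (fanVertex hm i) := by
    rw [SimpleGraph.fromEdgeSet_adj, Ne, fanVertex_inj hm (by omega) (by omega)]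
    exact ⟨Or.inl rfl, by omega⟩
  have hbr := SimpleGraph.isAcyclic_iff_forall_isBridge.1 hac
    ((SimpleGraph.mem_edgeSet _).2 h0)
  rw [SimpleGraph.isBridge_iff] at hbr
  apply hbr
  have hadj : ∀ {a b : ℕ}, a < 2 * m → b < 2 * m → a ≠ b →
      s(fanVertex hm a, fanVertex hm b) ∈ fanCycle hm i j → ¬ (a = 0 ∧ b = i) →
      ¬ (a = i ∧ b = 0) → ((SimpleGraph.fromEdgeSet (fanCycle hm i j)).deleteEdges
        {s(fanVertex hm 0, fanVertex hm i)}).Reachable (fanVertex hm a) (fanVertex hm b) := by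
    intro a b ha hb hab hmem h1 h2
    refine SimpleGraph.Adj.reachable ?_
    rw [SimpleGraph.deleteEdges_adj, SimpleGraph.fromEdgeSet_adj, Ne, fanVertex_inj hm ha hb,
      Set.mem_singleton_iff, fanEdge_eq_iff hm ha hb (by omega) (by omega)]
    exact ⟨⟨hmem, hab⟩, by omega⟩
  have hpath : ∀ k, i ≤ k → k ≤ j → ((SimpleGraph.fromEdgeSet (fanCycle hm i j)).deleteEdges
        {s(fanVertex hm 0, fanVertex hm i)}).Reachable (fanVertex hm i) (fanVertex hm k) := by
    intro k hik
    induction k, hik using Nat.le_induction with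
    | base => exact fun _ => SimpleGraph.Reachable.refl _
    | succ k hik ih =>
      intro hk
      exact (ih (by omega)).trans (hadj (by omega) (by omega) (by omega)
        (Or.inr (Or.inr ⟨k, ⟨hik, by omega⟩, rfl⟩)) (by omega) (by omega))
  exact (hadj (by omega) (by omega) (by omega) (Or.inr (Or.inl rfl)) (by omega) (by omega)).trans
    (hpath j hij.le le_rfl).symm

/-- The circuits of the fan through the spoke at `i` are the cycles that return by another
spoke. -/
theorem exists_eq_fanCycle_of_isCircuit (hm : 1 ≤ m) {C : Set (Sym2 (Fin (2 * m)))}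
    (hC : (polygonMatroid (fanGraph m)).IsCircuit C) {i : ℕ} (hi : 1 ≤ i) (him : i < 2 * m)
    (hiC : s(fanVertex hm 0, fanVertex hm i) ∈ C) :
    ∃ j, 1 ≤ j ∧ j < 2 * m ∧ j ≠ i ∧ s(fanVertex hm 0, fanVertex hm j) ∈ C ∧
      C = fanCycle hm (min i j) (max i j) := by
  -- Apply the cut property to the set of vertices that are joined to `i` by path edges in `C`.
  let S : Set (Fin (2 * m)) := {v | 1 ≤ (v : ℕ) ∧ ∀ k, min i v ≤ k → k < max i v →
    s(fanVertex hm k, fanVertex hm (k + 1)) ∈ C}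
  have hS : ∀ {a}, a < 2 * m → (fanVertex hm a ∈ S ↔ 1 ≤ a ∧ ∀ k, min i a ≤ k → k < max i a →
      s(fanVertex hm k, fanVertex hm (k + 1)) ∈ C) := fun {a} ha => by
    simp only [S, Set.mem_ofPred_eq, fanVertex_val hm ha]
  have hiS : fanVertex hm i ∈ S := (hS him).2 ⟨hi, fun k h1 h2 => by omega⟩
  have h0S : fanVertex hm 0 ∉ S := fun h => by
    have := ((hS (by omega)).1 h).1
    omega
  obtain ⟨c, hcS, d, hdS, hcd, hne⟩ :=
    exists_ne_mem_cut_of_isCircuit hC hiS h0S (Sym2.eq_swap ▸ hiC)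
  obtain ⟨c, hc, rfl⟩ := exists_fanVertex hm c
  obtain ⟨d, hd, rfl⟩ := exists_fanVertex hm d
  have hadj := (SimpleGraph.mem_edgeSet _).1 (hC.subset_ground hcd)
  rw [fanGraph_adj hm hc hd] at hadj
  obtain ⟨hc1, hcS⟩ := (hS hc).1 hcS
  rw [Ne, fanEdge_eq_iff hm hc hd him (by omega)] at hne
  by_cases hd0 : d = 0
  · subst hd0
    rw [Sym2.eq_swap] at hcd
    have hdep := fanCycle_not_indep hm (i := min i c) (j := max i c) (by omega) (by omega)
      (by omega)
    refine ⟨c, hc1, hc, by omega, hcd, (hC.eq_of_not_indep_subset hdep ?_).symm⟩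
    refine Set.insert_subset ?_ (Set.insert_subset ?_ ?_)
    · rcases min_choice i c with h | h <;> rw [h] <;> assumption
    · rcases max_choice i c with h | h <;> rw [h] <;> assumption
    · rintro _ ⟨k, hk, rfl⟩
      exact hcS k hk.1 hk.2
  · refine absurd ((hS hd).2 ⟨by omega, fun k hk1 hk2 => ?_⟩) hdS
    by_cases h : min i c ≤ k ∧ k < max i c
    · exact hcS k h.1 h.2
    · have h' : (k = c ∧ d = c + 1) ∨ (k = d ∧ c = d + 1) := by omega
      rcases h' with ⟨rfl, rfl⟩ | ⟨rfl, rfl⟩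
      · exact hcd
      · rwa [Sym2.eq_swap]

theorem fanCycle_isCircuit (hm : 1 ≤ m) {i : ℕ} (hi : 1 < i) (him : i < 2 * m) :
    (polygonMatroid (fanGraph m)).IsCircuit (fanCycle hm 1 i) := by
  obtain ⟨C, hCZ, hC⟩ := Matroid.Dep.exists_isCircuit_subset
    (M := polygonMatroid (fanGraph m)) ⟨fanCycle_not_indep hm le_rfl hi him,
      fanCycle_subset hm le_rfl hi him⟩
  have hspoke : ∀ {a}, 1 ≤ a → a < 2 * m → s(fanVertex hm 0, fanVertex hm a) ∈ C →
      a = 1 ∨ a = i := by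
    intro a ha1 ha h
    rcases hCZ h with h | h | ⟨k, hk, h⟩
    · rw [fanEdge_eq_iff hm (by omega) ha (by omega) (by omega)] at h
      omega
    · rw [fanEdge_eq_iff hm (by omega) ha (by omega) (by omega)] at h
      omega
    · have := hk.1
      have := hk.2
      simp only at h
      rw [fanEdge_eq_iff hm (by omega) (by omega) (by omega) ha] at h
      omega
  have h1 : ∃ a, 1 ≤ a ∧ a < 2 * m ∧ s(fanVertex hm 0, fanVertex hm a) ∈ C := by
    -- Otherwise the circuit would be contained in the path, each of whose edges is a cut.
    by_contra hcon
    push Not at hcon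
    have hpath : ∀ e ∈ C, ∃ k ∈ Set.Ico 1 i, s(fanVertex hm k, fanVertex hm (k + 1)) = e := by
      intro e he
      rcases hCZ he with rfl | rfl | h
      exacts [absurd he (hcon 1 le_rfl (by omega)), absurd he (hcon i (by omega) him), h]
    obtain ⟨e, he⟩ := hC.nonempty
    obtain ⟨k, hk, rfl⟩ := hpath e he
    have hk1 := hk.1
    have hk2 := hk.2
    obtain ⟨c, hcS, d, hdS, hcd, hne⟩ := exists_ne_mem_cut_of_isCircuit hC
      (S := {v | (v : ℕ) ≤ k}) (a := fanVertex hm k) (b := fanVertex hm (k + 1))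
      (by simp [fanVertex_val hm (show k < 2 * m by omega)])
      (by simp [fanVertex_val hm (show k + 1 < 2 * m by omega)]) he
    obtain ⟨l, hl, hle⟩ := hpath _ hcd
    have hl1 := hl.1
    have hl2 := hl.2
    obtain ⟨c, hc, rfl⟩ := exists_fanVertex hm c
    obtain ⟨d, hd, rfl⟩ := exists_fanVertex hm d
    rw [fanEdge_eq_iff hm (by omega) (by omega) hc hd] at hle
    rw [Ne, fanEdge_eq_iff hm hc hd (by omega) (by omega)] at hne
    simp only [Set.mem_ofPred_eq, fanVertex_val hm hc, fanVertex_val hm hd] at hcS hdS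
    omega
  obtain ⟨a, ha1, ha, haC⟩ := h1
  obtain ⟨j, hj1, hj, hja, hjC, hCeq⟩ := exists_eq_fanCycle_of_isCircuit hm hC ha1 ha haC
  have h2 := hspoke ha1 ha haC
  have h3 := hspoke hj1 hj hjC
  have h4 : min a j = 1 := by omega
  have h5 : max a j = i := by omega
  rwa [hCeq, h4, h5] at hC

theorem fanCycle_ncard_le (hm : 1 ≤ m) (i j : ℕ) : (fanCycle hm i j).ncard ≤ j - i + 2 := by
  refine (Set.ncard_insert_le _ _).trans (Nat.succ_le_succ ((Set.ncard_insert_le _ _).trans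
    (Nat.succ_le_succ ((Set.ncard_image_le (Set.finite_Ico i j)).trans ?_))))
  rw [← Finset.coe_Ico, Set.ncard_coe_finset, Nat.card_Ico]

theorem fanCycle_ncard (hm : 1 ≤ m) {i j : ℕ} (hi : 1 ≤ i) (hij : i < j) (hj : j < 2 * m) :
    (fanCycle hm i j).ncard = j - i + 2 := by
  have hfin := (Set.finite_Ico i j).image fun k => s(fanVertex hm k, fanVertex hm (k + 1))
  rw [fanCycle, Set.ncard_insert_of_notMem ?_ (hfin.insert _), Set.ncard_insert_of_notMem ?_ hfin,
    Set.InjOn.ncard_image, ← Finset.coe_Ico, Set.ncard_coe_finset, Nat.card_Ico]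
  · intro k hk l hl h
    have := hk.2
    have := hl.2
    simp only at h
    rw [fanEdge_eq_iff hm (by omega) (by omega) (by omega) (by omega)] at h
    omega
  · rintro ⟨k, hk, h⟩
    have := hk.1
    have := hk.2
    simp only at h
    rw [fanEdge_eq_iff hm (by omega) (by omega) (by omega) (by omega)] at h
    omega
  · rintro (h | ⟨k, hk, h⟩)
    · rw [fanEdge_eq_iff hm (by omega) (by omega) (by omega) (by omega)] at h
      omega
    · have := hk.1
      have := hk.2
      simp only at h
      rw [fanEdge_eq_iff hm (by omega) (by omega) (by omega) (by omega)] at h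
      omega

theorem spoke_eq (hm : 1 ≤ m) (k : Fin m) :
    spoke m k = s(fanVertex hm 0, fanVertex hm (m + k)) := by
  have := k.2
  simp only [spoke, fanVertex, Nat.zero_mod, Nat.mod_eq_of_lt (show m + (k : ℕ) < 2 * m by omega)]

/-- The longest circuits of the fan through the spoke at `m + k` have `m + k + 1` elements, since
`m + k` is at least as far from the end `1` of the path as from the end `2m - 1`. -/
theorem ncard_le_of_spoke_mem {C : Set (Sym2 (Fin (2 * m)))}
    (hC : (polygonMatroid (fanGraph m)).IsCircuit C) {k : Fin m} (hk : spoke m k ∈ C) :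
    C.ncard ≤ m + k + 1 := by
  have hkm := k.2
  have hm : 1 ≤ m := by omega
  rw [spoke_eq hm] at hk
  obtain ⟨j, hj1, hj, hjk, -, rfl⟩ :=
    exists_eq_fanCycle_of_isCircuit hm hC (by omega) (by omega) hk
  refine (fanCycle_ncard_le hm _ _).trans ?_
  omega

theorem exists_isCircuit_spoke_mem (hm : 2 ≤ m) (k : Fin m) :
    ∃ C, (polygonMatroid (fanGraph m)).IsCircuit C ∧ spoke m k ∈ C ∧ C.ncard = m + k + 1 := by
  have hkm := k.2
  have hm' : 1 ≤ m := by omega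
  refine ⟨fanCycle hm' 1 (m + k), fanCycle_isCircuit hm' (by omega) (by omega), ?_, ?_⟩
  · rw [spoke_eq hm']
    exact Or.inr (Or.inl rfl)
  · rw [fanCycle_ncard hm' le_rfl (by omega) (by omega)]
    omega

theorem spoke_indep (k : Fin m) : (polygonMatroid (fanGraph m)).Indep {spoke m k} := by
  have hkm := k.2
  have hm : 1 ≤ m := by omega
  have hE : {spoke m k} ⊆ (polygonMatroid (fanGraph m)).E := by
    rw [Set.singleton_subset_iff, spoke_eq hm, polygonMatroid_ground, SimpleGraph.mem_edgeSet,
      fanGraph_adj hm (by omega) (by omega)]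
    omega
  by_contra h
  obtain ⟨C, hCk, hC⟩ := Matroid.Dep.exists_isCircuit_subset ⟨h, hE⟩
  have h1 := (three_le_ncard_le_of_isCircuit hC).1
  have h2 := Set.ncard_le_ncard hCk
  rw [Set.ncard_singleton] at h2
  omega

end Fan

/-! ### An isomorphism invariant -/

section Invariant

variable {α : Type u} {β : Type v}

theorem Isomorphic.symm {M : Matroid α} {N : Matroid β} (h : Isomorphic M N) :
    Isomorphic N M := by
  obtain ⟨φ, hφ⟩ := h
  refine ⟨φ.symm, fun I => ?_⟩
  rw [hφ, Equiv.image_symm_image]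

/-- The sizes less than `n` of the circuits that meet a circuit of size `n`. -/
def smallCircuitSizes (M : Matroid α) (n : ℕ) : Set ℕ :=
  {s | s < n ∧ ∃ C D, M.IsCircuit C ∧ M.IsCircuit D ∧ C.ncard = s ∧ D.ncard = n ∧ (C ∩ D).Nonempty}

theorem Isomorphic.smallCircuitSizes_subset {M : Matroid α} {N : Matroid β} (h : Isomorphic M N)
    (n : ℕ) : smallCircuitSizes M n ⊆ smallCircuitSizes N n := by
  obtain ⟨φ, hφ⟩ := h
  have hcirc : ∀ I : Set M.E, M.IsCircuit (Subtype.val '' I) →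
      N.IsCircuit (Subtype.val '' (φ '' I)) := by
    intro I hI
    rw [Matroid.isCircuit_iff_dep_forall_sdiff_singleton_indep] at hI ⊢
    refine ⟨⟨fun h => hI.1.not_indep ((hφ I).2 h), Subtype.coe_image_subset _ _⟩, ?_⟩
    rintro _ ⟨_, ⟨i, hi, rfl⟩, rfl⟩
    have h1 := hI.2 i ⟨i, hi, rfl⟩
    rw [← Set.image_singleton, ← Set.image_sdiff Subtype.val_injective] at h1 ⊢
    rw [← Set.image_singleton, ← Set.image_sdiff φ.injective]
    exact (hφ _).1 h1
  have hlift : ∀ C, M.IsCircuit C → ∃ I : Set M.E, C = Subtype.val '' I := fun C hC =>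
    ⟨Subtype.val ⁻¹' C, by
      rw [Subtype.image_preimage_coe, Set.inter_eq_self_of_subset_right hC.subset_ground]⟩
  have hcard : ∀ I : Set M.E, (Subtype.val '' (φ '' I)).ncard = (Subtype.val '' I).ncard :=
    fun I => by
      rw [Set.ncard_image_of_injective _ Subtype.val_injective,
        Set.ncard_image_of_injective _ φ.injective,
        Set.ncard_image_of_injective _ Subtype.val_injective]
  rintro s ⟨hs, C, D, hC, hD, hCs, hDn, hCD⟩
  obtain ⟨I, rfl⟩ := hlift C hC
  obtain ⟨J, rfl⟩ := hlift D hD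
  refine ⟨hs, _, _, hcirc I hC, hcirc J hD, (hcard I).trans hCs, (hcard J).trans hDn, ?_⟩
  rw [← Set.image_inter Subtype.val_injective] at hCD ⊢
  rw [← Set.image_inter φ.injective]
  exact (hCD.of_image.image _).image _

end Invariant

/-! ### The parallel connections of a cycle and a fan -/

section CycleFan

variable {m n : ℕ} {k : Fin m} {P : Matroid (Quotient (glue 1 (spoke m k)))}

theorem ncard_left_image (S : Set ℕ) : (left 1 (spoke m k) '' S).ncard = S.ncard :=
  Set.ncard_image_of_injective _ (left_injective _ _)

theorem ncard_right_image (S : Set (Sym2 (Fin (2 * m)))) :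
    (right 1 (spoke m k) '' S).ncard = S.ncard :=
  Set.ncard_image_of_injective _ (right_injective _ _)

theorem ncard_Icc_one (n : ℕ) : (Set.Icc 1 n).ncard = n := by
  rw [← Finset.coe_Icc, Set.ncard_coe_finset, Nat.card_Icc, Nat.add_sub_cancel]

/-- The circuits of the parallel connection of the `n`-cycle and the fan: the `n`-cycle, the
circuits of the fan, which are smaller, and larger ones. -/
theorem isCircuit_cases (hn : 2 * m + 1 < n) (hP : IsParallelConnection (cycleMatroid n)
    (polygonMatroid (fanGraph m)) 1 (spoke m k) P) {D} (hD : P.IsCircuit D) :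
    (D = left 1 (spoke m k) '' Set.Icc 1 n ∧ D.ncard = n) ∨
      (∃ C, (polygonMatroid (fanGraph m)).IsCircuit C ∧ D = right 1 (spoke m k) '' C ∧
        3 ≤ D.ncard ∧ D.ncard < n ∧ D.ncard = C.ncard) ∨ n < D.ncard := by
  rcases (hP.isCircuit_iff D).1 hD with (⟨C, hC, rfl⟩ | ⟨C, hC, rfl⟩) |
    ⟨C, C', hC, -, hC', hkC', rfl⟩
  · rw [cycleMatroid_isCircuit_iff (by omega)] at hC
    subst hC
    exact Or.inl ⟨rfl, by rw [ncard_left_image, ncard_Icc_one]⟩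
  · have h := three_le_ncard_le_of_isCircuit hC
    rw [Nat.card_fin] at h
    refine Or.inr (Or.inl ⟨C, hC, rfl, ?_⟩)
    rw [ncard_right_image]
    omega
  · rw [cycleMatroid_isCircuit_iff (by omega)] at hC
    subst hC
    refine Or.inr (Or.inr ?_)
    have h := three_le_ncard_le_of_isCircuit hC'
    rw [Set.ncard_union_eq ?_ (((Set.finite_Icc 1 n).sdiff).image _) (Set.toFinite _),
      ncard_left_image, ncard_right_image, Set.ncard_sdiff_singleton_of_mem hkC',
      Set.ncard_sdiff_singleton_of_mem (show 1 ∈ Set.Icc 1 n from ⟨le_rfl, by omega⟩),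
      ncard_Icc_one]
    · omega
    · rw [Set.disjoint_left]
      rintro _ ⟨a, ha, rfl⟩ ⟨b, hb, hab⟩
      exact ha.2 (left_eq_right_iff.1 hab.symm).1

theorem isSimple_sum_isthmus (hn : 2 * m + 1 < n) (hP : IsParallelConnection (cycleMatroid n)
    (polygonMatroid (fanGraph m)) 1 (spoke m k) P) : IsSimple (P.sum isthmus) := by
  intro e he f hf
  by_contra h
  obtain ⟨D, hDef, hD⟩ := Matroid.Dep.exists_isCircuit_subset
    ⟨h, Set.insert_subset he (Set.singleton_subset_iff.2 hf)⟩
  have h1 : D.ncard ≤ 2 := (Set.ncard_le_ncard hDef (Set.toFinite _)).trans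
    ((Set.ncard_insert_le _ _).trans (by rw [Set.ncard_singleton]))
  obtain ⟨C, hC', rfl⟩ := (sum_isthmus_isCircuit_iff P D).1 hD
  rw [Set.ncard_image_of_injective _ Sum.inl_injective] at h1
  have hk := k.2
  rcases isCircuit_cases hn hP hC' with ⟨-, h2⟩ | ⟨_, _, _, h2, _⟩ | h2 <;> omega

theorem le_of_mem_smallCircuitSizes (hn : 2 * m + 1 < n)
    (hP : IsParallelConnection (cycleMatroid n) (polygonMatroid (fanGraph m)) 1 (spoke m k) P)
    {s : ℕ} (hs : s ∈ smallCircuitSizes (P.sum isthmus) n) : s ≤ m + k + 1 := by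
  obtain ⟨hsn, C, D, hC, hD, hCs, hDn, hCD⟩ := hs
  obtain ⟨C, hCP, rfl⟩ := (sum_isthmus_isCircuit_iff P _).1 hC
  obtain ⟨D, hDP, rfl⟩ := (sum_isthmus_isCircuit_iff P _).1 hD
  rw [Set.ncard_image_of_injective _ Sum.inl_injective] at hCs hDn
  rw [← Set.image_inter Sum.inl_injective] at hCD
  obtain ⟨e, heC, heD⟩ := hCD.of_image
  rcases isCircuit_cases hn hP hDP with ⟨rfl, -⟩ | ⟨_, _, _, h2, h3, _⟩ | h2
  · rcases isCircuit_cases hn hP hCP with h2 | ⟨C, hC', rfl, -, -, h2⟩ | h2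
    · omega
    · obtain ⟨a, -, rfl⟩ := heD
      obtain ⟨b, hb, hab⟩ := heC
      rw [(left_eq_right_iff.1 hab.symm).2] at hb
      rw [← hCs, h2]
      exact ncard_le_of_spoke_mem hC' hb
    · omega
  · omega
  · omega

theorem mem_smallCircuitSizes (hm : 2 ≤ m) (hn : 2 * m + 1 < n)
    (hP : IsParallelConnection (cycleMatroid n) (polygonMatroid (fanGraph m)) 1 (spoke m k) P) :
    m + k + 1 ∈ smallCircuitSizes (P.sum isthmus) n := by
  have hk := k.2
  obtain ⟨C, hC, hkC, hCcard⟩ := exists_isCircuit_spoke_mem hm k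
  refine ⟨by omega, Sum.inl '' (right 1 (spoke m k) '' C),
    Sum.inl '' (left 1 (spoke m k) '' Set.Icc 1 n), ?_, ?_, ?_, ?_, ?_⟩
  · exact (sum_isthmus_isCircuit_iff P _).2
      ⟨_, (hP.isCircuit_iff _).2 (Or.inl (Or.inr ⟨C, hC, rfl⟩)), rfl⟩
  · exact (sum_isthmus_isCircuit_iff P _).2 ⟨_, (hP.isCircuit_iff _).2 (Or.inl (Or.inl
      ⟨_, (cycleMatroid_isCircuit_iff (by omega) _).2 rfl, rfl⟩)), rfl⟩
  · rw [Set.ncard_image_of_injective _ Sum.inl_injective, ncard_right_image, hCcard]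
  · rw [Set.ncard_image_of_injective _ Sum.inl_injective, ncard_left_image, ncard_Icc_one]
  · rw [← Set.image_inter Sum.inl_injective]
    exact Set.Nonempty.image _ ⟨right 1 (spoke m k) (spoke m k), ⟨_, hkC, rfl⟩,
      ⟨1, ⟨le_rfl, by omega⟩, left_eq_right _ _⟩⟩

end CycleFan

end OSMatroid

end

theorem corollary2 (m n : ℕ) (hm : 1 ≤ m) (hn : 2 * m + 1 < n) :
    ∃ M : (k : Fin m) → Matroid (Quotient (OSMatroid.glue (1 : ℕ) (OSMatroid.spoke m k)) ⊕ Unit),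
      (∀ k : Fin m, ∃ P : Matroid (Quotient (OSMatroid.glue (1 : ℕ) (OSMatroid.spoke m k))),
        OSMatroid.IsParallelConnection (OSMatroid.cycleMatroid n)
          (OSMatroid.polygonMatroid (OSMatroid.fanGraph m)) 1 (OSMatroid.spoke m k) P ∧
        M k = P.sum OSMatroid.isthmus) ∧
      (∀ k : Fin m, (M k).Finite ∧ OSMatroid.IsSimple (M k)) ∧
      (∀ k l : Fin m, k ≠ l → ¬ OSMatroid.Isomorphic (M k) (M l)) ∧
      (∀ (R : Type*) [CommRing R], ∀ k l : Fin m, OSMatroid.OSIsomorphic R (M k) (M l)) := by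
  have hex := fun k : Fin m => OSMatroid.exists_isParallelConnection_cycleMatroid
    (show 2 ≤ n by omega) (OSMatroid.spoke_indep k)
  choose P hP using hex
  refine ⟨fun k => (P k).sum OSMatroid.isthmus, fun k => ⟨P k, hP k, rfl⟩, fun k => ⟨⟨?_⟩,
    OSMatroid.isSimple_sum_isthmus hn (hP k)⟩, fun k l hkl hiso => hkl ?_, fun R _ k l =>
    (OSMatroid.osIsomorphic_parallelConnection_sum_isthmus (hP k)).trans
      (OSMatroid.osIsomorphic_parallelConnection_sum_isthmus (hP l)).symm⟩
  · rw [Matroid.sum_ground, (hP k).ground_eq]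
    exact ((((Set.finite_Icc 1 n).image _).union (Set.toFinite _)).image _).union (Set.toFinite _)
  · have hm2 : 2 ≤ m := by
      have := k.2
      have := l.2
      have : (k : ℕ) ≠ l := fun h => hkl (Fin.ext h)
      omega
    have h1 := OSMatroid.le_of_mem_smallCircuitSizes hn (hP l) (hiso.smallCircuitSizes_subset n
      (OSMatroid.mem_smallCircuitSizes hm2 hn (hP k)))
    have h2 := OSMatroid.le_of_mem_smallCircuitSizes hn (hP k)
      (hiso.symm.smallCircuitSizes_subset n (OSMatroid.mem_smallCircuitSizes hm2 hn (hP l)))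
    exact Fin.ext (by omega)
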